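/- **Construction.** A *sparse embedding matrix* with $m$ rows and $N$ columns is $\Phi D$, where $\Phi\in\{0,1\}^{m\times N}$ has exactly one $1$ in each column $i$, in row $h(i)$, with $h:[N]\to[m]$ uniformly random, and $D$ is an independent $N\times N$ diagonal matrix of independent uniform $\pm1$ entries. A *sparse JL block* (Kane–Nelson) with parameters $a,v$ is the matrix with $av$ rows obtained by stacking $a$ independent sparse embedding matrices with $v$ rows each, all scaled by $1/\sqrt a$. A *generalized sparse embedding matrix* $S$ with parameters $a,v,q$ and $n$ columns is obtained by choosing a uniformly random $h:[n]\to[q]$ and independent sparse JL blocks $B^{(1)},\dots,B^{(q)}$ with parameters $a,v$, where $B^{(b)}$ has $|h^{-1}(b)|$ columns, and setting $S=\mathrm{diag}(B^{(1)},\dots,B^{(q)})\cdot P$, where $P$ is the permutation matrix that sorts the coordinates by their bucket. So $S$ has $t=avq$ rows. **Theorem.** There is an absolute constant $c_0>0$ such that for every $c_q\ge c_0$ there are constants $c_a,c_v,C>0$ (depending only on $c_q$) for which the following holds. Let $A\in\mathbb R^{n\times d}$ have rank $r$, let $\varepsilon,\delta\in(0,1)$ with $r/(\varepsilon\delta)\ge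 2$ (so $r\ge1$; for $r\geq 1$ this is automatic unless $r=1$ and $\varepsilon\delta>1/2$), and let $S$ be a generalized sparse embedding matrix with $n$ columns and parameters $$a=\Big\lceil c_a\varepsilon^{-1}\log\tfrac{r}{\varepsilon\delta}\Big\rceil,\qquad v=\lceil c_v\varepsilon^{-1}\rceil,\qquad q=\Big\lceil c_q\, r\,\varepsilon^{-2}\big(r+\log\tfrac1{\varepsilon\delta}\big)\Big\rceil .$$ 1. The number of rows of $S$ satisfies $t=avq\le C\,r\,\varepsilon^{-4}\log\frac{r}{\varepsilon\delta}\,\big(r+\log\frac1{\varepsilon\delta}\big)$. 2. With probability at least $1-\delta$, $S$ is an embedding matrix for $A$: for all $y$ in the column space of $A$, $(1-\varepsilon)\|y\|_2\le\|Sy\|_2\le(1+\varepsilon)\|y\|_2$. 3. For every outcome of $S$, the product $SA$ can be computed in at most $C\,\mathrm{nnz}(A)\,\varepsilon^{-1}\log\frac{r}{\varepsilon\delta}$ steps, where $\mathrm{nnz}(A)$ is the number of nonzero entries of $A$. In particular, for every $\kappa\ge0$, if $1/\varepsilon\le(r/\delta)^\kappa$ then it takes at most $C(1+\kappa)\,\mathrm{nnz}(A)\,\varepsilon^{-1}\log\frac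 r\delta$ steps. In (3), a single program, fixed independently of all parameters and constants above, runs on a unit-cost random access machine with natural-number and real registers and arrays (arithmetic, comparisons, indirect addressing; unused memory is initially zero). The input is the list, in any order, of the nonzero entries of $A$ with their positions, together with the parameters, hash functions, signs and scaling factor $1/\sqrt a$ that describe $S$; the output is the matrix $SA$ in row-major order. -/

import Mathlib

open MeasureTheory ProbabilityTheory

noncomputable section

/-! ### Sparse embeddings and generalized sparse embeddings -/

/-- The sign encoded by a bit. -/
def bitSign (b : Bool) : ℝ := if b then 1 else -1

/-- The sparse embedding matrix `Φ D`: `Φ` is the 0/1 matrix with a single 1 in column `i`, in row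
`h i`, and `D` is the diagonal matrix of the signs `s i`. -/
def sparseEmbedding {ι κ : Type*} [Fintype ι] [DecidableEq ι] [DecidableEq κ]
    (h : ι → κ) (s : ι → Bool) : Matrix κ ι ℝ :=
  (Matrix.of fun m i => if h i = m then (1 : ℝ) else 0) * Matrix.diagonal fun i => bitSign (s i)

/-- The sparse Johnson-Lindenstrauss block of Kane and Nelson: `a` sparse embedding matrices with
`v` rows each, scaled by `1/√a` and stacked on top of each other. -/
def sparseJL {ι : Type*} [Fintype ι] [DecidableEq ι] {a v : ℕ}
    (g : Fin a → ι → Fin v) (s : Fin a → ι → Bool) : Matrix (Fin a × Fin v) ι ℝ :=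
  Matrix.of fun jm i => (1 / √(a : ℝ)) * sparseEmbedding (g jm.1) (s jm.1) jm.2 i

/-- The randomness behind a generalized sparse embedding matrix: the bucket `h i` of each
coordinate `i`, and for each `j < a` the row `g j i` and the sign `s j i` that coordinate `i`
receives in the `j`-th sparse embedding of the block of its bucket. All of these are independent
and uniform, that is, the seed `(h, g, s)` is uniform. (A coordinate lies in one bucket only, so
blocks of different buckets use disjoint, hence independent, parts of `g` and `s`.) -/
abbrev EmbeddingSeed (n a v q : ℕ) : Type :=
  (Fin n → Fin q) × (Fin a → Fin n → Fin v) × (Fin a → Fin n → Bool)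

/-- The block of bucket `b`: a sparse Johnson-Lindenstrauss block whose columns are the
coordinates in `h⁻¹(b)`. -/
def bucketBlock {n a v q : ℕ} (ω : EmbeddingSeed n a v q) (b : Fin q) :
    Matrix (Fin a × Fin v) {i : Fin n // ω.1 i = b} ℝ :=
  sparseJL (fun j i => ω.2.1 j i.1) (fun j i => ω.2.2 j i.1)

/-- The generalized sparse embedding matrix: the block-diagonal matrix of the blocks of the `q`
buckets, composed with the permutation that sorts the coordinates by bucket. It has
`q * a * v` rows, indexed by (bucket, index of the sparse embedding, row in it). -/
def generalizedEmbedding {n a v q : ℕ} (ω : EmbeddingSeed n a v q) :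
    Matrix (Fin q × Fin a × Fin v) (Fin n) ℝ :=
  (Matrix.blockDiagonal' (bucketBlock ω)).submatrix
    (Equiv.sigmaEquivProd (Fin q) (Fin a × Fin v)).symm (Equiv.sigmaFiberEquiv ω.1).symm

/-- `S` is an embedding matrix for `A` with distortion `ε`: `‖S y‖₂ = (1 ± ε) ‖y‖₂` for all `y`
in the column space of `A`. -/
def IsSubspaceEmbedding {ρ : Type*} [Fintype ρ] {n d : ℕ} (S : Matrix ρ (Fin n) ℝ)
    (A : Matrix (Fin n) (Fin d) ℝ) (ε : ℝ) : Prop :=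
  ∀ y ∈ LinearMap.range A.mulVecLin,
    (1 - ε) * ‖WithLp.toLp 2 y‖ ≤ ‖WithLp.toLp 2 (S.mulVec y)‖ ∧
      ‖WithLp.toLp 2 (S.mulVec y)‖ ≤ (1 + ε) * ‖WithLp.toLp 2 y‖

/-- The positions of the nonzero entries of `A`. -/
abbrev NonzeroPos {n d : ℕ} (A : Matrix (Fin n) (Fin d) ℝ) : Type :=
  {p : Fin n × Fin d // A p.1 p.2 ≠ 0}

/-- The number of nonzero entries of `A`. -/
def nnz {n d : ℕ} (A : Matrix (Fin n) (Fin d) ℝ) : ℕ := Nat.card (NonzeroPos A)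

/-! ### A unit-cost random access machine over the reals -/

namespace RealRAM

/-- Instructions. There are integer registers (holding natural numbers) and real registers, both
addressed directly, and integer and real arrays, read and written at the index that an integer
register holds. `l` is a jump target and `k` the number of an array. -/
inductive Instr where
  | jump (l : ℕ)
  | iconst (x c : ℕ)
  | iadd (x y z : ℕ)
  | isub (x y z : ℕ)
  | imul (x y z : ℕ)
  | ijlt (x y l : ℕ)
  | iload (x k y : ℕ)
  | istore (k y x : ℕ)
  | rconst (x : ℕ) (c : ℤ)
  | radd (x y z : ℕ)
  | rsub (x y z : ℕ)
  | rmul (x y z : ℕ)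
  | rdiv (x y z : ℕ)
  | rjlt (x y l : ℕ)
  | rload (x k y : ℕ)
  | rstore (k y x : ℕ)

/-- A program is a finite list of instructions. -/
abbrev Program : Type := List Instr

/-- A configuration: program counter, registers and arrays. -/
structure State where
  pc : ℕ
  ireg : ℕ → ℕ
  rreg : ℕ → ℝ
  iarr : ℕ → ℕ → ℕ
  rarr : ℕ → ℕ → ℝ

/-- Advance to the next instruction, with an integer register changed. -/
def State.setI (σ : State) (x c : ℕ) : State :=
  { σ with pc := σ.pc + 1, ireg := Function.update σ.ireg x c }

/-- Advance to the next instruction, with a real register changed. -/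
def State.setR (σ : State) (x : ℕ) (c : ℝ) : State :=
  { σ with pc := σ.pc + 1, rreg := Function.update σ.rreg x c }

/-- The effect of one instruction. -/
def exec : Instr → State → State
  | .jump l, σ => { σ with pc := l }
  | .iconst x c, σ => σ.setI x c
  | .iadd x y z, σ => σ.setI x (σ.ireg y + σ.ireg z)
  | .isub x y z, σ => σ.setI x (σ.ireg y - σ.ireg z)
  | .imul x y z, σ => σ.setI x (σ.ireg y * σ.ireg z)
  | .ijlt x y l, σ => { σ with pc := if σ.ireg x < σ.ireg y then l else σ.pc + 1 }
  | .iload x k y, σ => σ.setI x (σ.iarr k (σ.ireg y))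
  | .istore k y x, σ =>
      { σ with
        pc := σ.pc + 1
        iarr := Function.update σ.iarr k
          (Function.update (σ.iarr k) (σ.ireg y) (σ.ireg x)) }
  | .rconst x c, σ => σ.setR x c
  | .radd x y z, σ => σ.setR x (σ.rreg y + σ.rreg z)
  | .rsub x y z, σ => σ.setR x (σ.rreg y - σ.rreg z)
  | .rmul x y z, σ => σ.setR x (σ.rreg y * σ.rreg z)
  | .rdiv x y z, σ => σ.setR x (σ.rreg y / σ.rreg z)
  | .rjlt x y l, σ => { σ with pc := if σ.rreg x < σ.rreg y then l else σ.pc + 1 }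
  | .rload x k y, σ => σ.setR x (σ.rarr k (σ.ireg y))
  | .rstore k y x, σ =>
      { σ with
        pc := σ.pc + 1
        rarr := Function.update σ.rarr k
          (Function.update (σ.rarr k) (σ.ireg y) (σ.rreg x)) }

/-- One step: execute the instruction at the program counter. Outside the program, the machine
has halted and nothing changes. -/
def step (P : Program) (σ : State) : State :=
  match P[σ.pc]? with
  | none => σ
  | some i => exec i σ

/-- The program `P`, started in `σ`, has halted after `k` steps, in the configuration `τ`. -/
def HaltsIn (P : Program) (σ : State) (k : ℕ) (τ : State) : Prop :=
  (step P)^[k] σ = τ ∧ P.length ≤ τ.pc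

/-- A finite sequence as the contents of an array; the cells beyond it hold zero. -/
def arrayOf {α : Type*} [Zero α] {m : ℕ} (f : Fin m → α) : ℕ → α :=
  fun p => if h : p < m then f ⟨p, h⟩ else 0

/-- The contents of an array that stores an `m × m'` table in row-major order. -/
def tableOf {α : Type*} [Zero α] {m m' : ℕ} (f : Fin m → Fin m' → α) : ℕ → α :=
  arrayOf fun p : Fin (m * m') => f (finProdFinEquiv.symm p).1 (finProdFinEquiv.symm p).2

/-- The initial configuration for the task of applying a generalized sparse embedding matrix to
`A`. The matrix `A` is given by the list (in the arbitrary order `e`) of the rows, columns and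
values of its nonzero entries; the embedding by its parameters, its hash functions and signs
and its scaling factor `1/√a`. All other registers and cells hold zero. -/
def initial {n d a v q : ℕ} (A : Matrix (Fin n) (Fin d) ℝ) (e : Fin (nnz A) ≃ NonzeroPos A)
    (ω : EmbeddingSeed n a v q) : State where
  pc := 0
  ireg := arrayOf ![n, d, nnz A, a, v, q]
  rreg := arrayOf ![1 / √(a : ℝ)]
  iarr k :=
    match k with
    | 0 => arrayOf fun p => ((e p).1.1 : ℕ)
    | 1 => arrayOf fun p => ((e p).1.2 : ℕ)
    | 2 => arrayOf fun i => (ω.1 i : ℕ)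
    | 3 => tableOf fun i j => (ω.2.1 j i : ℕ)
    | _ => 0
  rarr k :=
    match k with
    | 0 => arrayOf fun p => A (e p).1.1 (e p).1.2
    | 1 => tableOf fun i j => bitSign (ω.2.2 j i)
    | _ => 0

/-- Real array number 2 holds the matrix `M`, in row-major order. -/
def Outputs {q a v d : ℕ} (τ : State) (M : Matrix (Fin q × Fin a × Fin v) (Fin d) ℝ) : Prop :=
  ∀ (b : Fin q) (j : Fin a) (m : Fin v) (k : Fin d),
    τ.rarr 2 ((((b : ℕ) * a + j) * v + m) * d + k) = M (b, j, m) k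

end RealRAM

end

/-!
Let `Z` be `√a * S y`. Its entries are signed sums of the coordinates of `y` over cells
`(h i, j, g j i)`, so once the hash functions are fixed, `‖S y‖² - ‖y‖²` is a Rademacher chaos of
order two that splits over the cells. Everything rests on one exponential moment bound for such a
chaos, `expect_exp_chaos_le`. It is proved by averaging out one sign at a time, and it allows part of
the signs to be frozen: then every cell starts from the signed sum of its frozen coordinates.

Write `r` for the rank of `A`, `R = r / (ε δ)` and `L = r + log (1 / (ε δ))`. A coordinate is heavy
if its leverage score in the column space of `A` is at least `T = ε / L`; there are at most
`r L / ε ≤ ε q / 3` heavy coordinates. The sum of the truncated scores `min (u i / T) 1` is bounded by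
the same number, and a Chernoff bound for them (`expect_bucket_load_le`) shows that, except with small
probability, no bucket has a load above `m ≈ 10 log R`. So every bucket contains at most `m` heavy
coordinates, and light coordinates of total leverage at most `m T`.

* Heavy coordinates. For a vector supported on the heavy coordinates of one bucket, the `a`
  independent sparse embeddings each contribute a chaos of variance `O(1 / v)`, hence a deviation
  above `ε` has probability `exp (-Ω(a ε))` (`expect_sketch_tail_le`); this survives a union bound
  over a net of the coordinate subspace, which has `25 ^ m = R ^ O(1)` points, and over the buckets.
  Different buckets use different rows, so all vectors supported on heavy coordinates are preserved
  (`expect_not_goodOn_heavy_le`).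
* Light coordinates. Freeze the signs of the heavy coordinates. The remaining part of
  `‖S y‖²`, cross terms included, is a chaos whose cells have mass at most `m T`, and the frozen sums
  have total square `a ‖S y_H‖² = O(a)`. A deviation above `ε` therefore has probability
  `exp (-Ω(a ε² / (m T))) = exp (-Ω(L))`, which survives a union bound over a net of the column space,
  with `25 ^ r` points (`expect_not_lightGood_le`).

Nets of these sizes control quadratic forms by `exists_quadratic_net`. Probabilities are averages
over the finite type of seeds.

The machine program is a double loop over the nonzero entries of `A` and the `a` sparse embeddings;
loop invariants give its output and its number of steps (`RealRAM.sketchProgram_spec`).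
-/

noncomputable section

open scoped BigOperators

/-! ### Applying the embedding on the random access machine -/

namespace RealRAM

/-- The program that computes `S * A`. Instructions 1-11 run through the nonzero entries `p` of
`A`; they put the column of the entry into register 9 and its scaled value into real register 1,
and start registers 8, 10, 11 at `i * a`, `h i * a`, `0`, where `i` is the row of the entry.
Instructions 12-27 run through `j < a` and add `±A i k / √a` to the cell of row
`(h i, j, g j i)` and column `k` of the output. -/
def sketchProgram : Program :=
  [.iconst 7 1,
   .ijlt 6 2 3, .jump 28,
   .iload 8 0 6, .iload 9 1 6, .iload 10 2 8, .rload 1 0 6, .rmul 1 1 0,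
   .imul 10 10 3, .imul 8 8 3, .iadd 6 6 7, .iconst 11 0,
   .ijlt 11 3 14, .jump 1,
   .iload 12 3 8, .rload 2 1 8, .imul 13 10 4, .iadd 13 13 12, .imul 13 13 1, .iadd 13 13 9,
   .rmul 2 2 1, .rload 3 2 13, .radd 3 3 2, .rstore 2 13 3,
   .iadd 8 8 7, .iadd 10 10 7, .iadd 11 11 7, .jump 12]

/-- The output cell to which the `p`-th nonzero entry contributes in the `j`-th embedding. -/
def targetCell (σ₀ : State) (p j : ℕ) : ℕ :=
  ((σ₀.iarr 2 (σ₀.iarr 0 p) * σ₀.ireg 3 + j) * σ₀.ireg 4 +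
    σ₀.iarr 3 (σ₀.iarr 0 p * σ₀.ireg 3 + j)) * σ₀.ireg 1 + σ₀.iarr 1 p

/-- The amount which the `p`-th nonzero entry contributes in the `j`-th embedding. -/
def contribution (σ₀ : State) (p j : ℕ) : ℝ :=
  σ₀.rarr 1 (σ₀.iarr 0 p * σ₀.ireg 3 + j) * (σ₀.rarr 0 p * σ₀.rreg 0)

/-- The part of the configuration that neither loop changes, with the output array equal to
`f`. -/
structure Frame (σ₀ σ : State) (f : ℕ → ℝ) : Prop where
  r1 : σ.ireg 1 = σ₀.ireg 1
  r2 : σ.ireg 2 = σ₀.ireg 2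
  r3 : σ.ireg 3 = σ₀.ireg 3
  r4 : σ.ireg 4 = σ₀.ireg 4
  r7 : σ.ireg 7 = 1
  s0 : σ.rreg 0 = σ₀.rreg 0
  iarr : σ.iarr = σ₀.iarr
  a0 : σ.rarr 0 = σ₀.rarr 0
  a1 : σ.rarr 1 = σ₀.rarr 1
  out : σ.rarr 2 = f

/-- The invariant of the outer loop: the first `p` nonzero entries have been processed. -/
structure OuterInv (σ₀ σ : State) (p : ℕ) (f : ℕ → ℝ) : Prop extends Frame σ₀ σ f where
  pc : σ.pc = 1
  r6 : σ.ireg 6 = p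

/-- The invariant of the inner loop: entry `p` has been processed in the first `j` embeddings. -/
structure InnerInv (σ₀ σ : State) (p j : ℕ) (f : ℕ → ℝ) : Prop extends Frame σ₀ σ f where
  pc : σ.pc = 12
  r6 : σ.ireg 6 = p + 1
  r8 : σ.ireg 8 = σ₀.iarr 0 p * σ₀.ireg 3 + j
  r9 : σ.ireg 9 = σ₀.iarr 1 p
  r10 : σ.ireg 10 = σ₀.iarr 2 (σ₀.iarr 0 p) * σ₀.ireg 3 + j
  r11 : σ.ireg 11 = j
  s1 : σ.rreg 1 = σ₀.rarr 0 p * σ₀.rreg 0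

lemma InnerInv.next {σ₀ σ : State} {p j : ℕ} {f : ℕ → ℝ} (H : InnerInv σ₀ σ p j f)
    (hj : j < σ₀.ireg 3) :
    InnerInv σ₀ ((step sketchProgram)^[15] σ) p (j + 1)
      (fun x => f x + if targetCell σ₀ p j = x then contribution σ₀ p j else 0) := by
  obtain ⟨⟨r1, r2, r3, r4, r7, s0, hi, a0, a1, out⟩, pc, r6, r8, r9, r10, r11, s1⟩ := H
  obtain ⟨c, ir, rr, ia, ra⟩ := σ
  simp only at *
  subst pc hi
  have hlt : ir 11 < ir 3 := by omega
  simp [Function.iterate_succ_apply, step, sketchProgram, exec, State.setI, State.setR, hlt]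
  constructor
  · constructor <;> simp_all
    ext x
    simp [Function.update_apply, contribution, targetCell, eq_comm]
    split_ifs <;> simp_all
  all_goals simp_all [add_assoc]

lemma InnerInv.exit {σ₀ σ : State} {p : ℕ} {f : ℕ → ℝ} (H : InnerInv σ₀ σ p (σ₀.ireg 3) f) :
    OuterInv σ₀ ((step sketchProgram)^[2] σ) (p + 1) f := by
  obtain ⟨⟨r1, r2, r3, r4, r7, s0, hi, a0, a1, out⟩, pc, r6, r8, r9, r10, r11, s1⟩ := H
  obtain ⟨c, ir, rr, ia, ra⟩ := σ
  simp only at *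
  subst pc hi
  have hlt : ¬ ir 11 < ir 3 := by omega
  simp [Function.iterate_succ_apply, step, sketchProgram, exec, hlt]
  constructor
  · constructor <;> simp_all
  all_goals simp_all

lemma OuterInv.enter {σ₀ σ : State} {p : ℕ} {f : ℕ → ℝ} (H : OuterInv σ₀ σ p f)
    (hp : p < σ₀.ireg 2) : InnerInv σ₀ ((step sketchProgram)^[10] σ) p 0 f := by
  obtain ⟨⟨r1, r2, r3, r4, r7, s0, hi, a0, a1, out⟩, pc, r6⟩ := H
  obtain ⟨c, ir, rr, ia, ra⟩ := σ
  simp only at *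
  subst pc hi
  have hlt : ir 6 < ir 2 := by omega
  simp [Function.iterate_succ_apply, step, sketchProgram, exec, State.setI, State.setR, hlt]
  constructor
  · constructor <;> simp_all
  all_goals simp_all

lemma OuterInv.inner {σ₀ σ : State} {p : ℕ} {f : ℕ → ℝ} (H : OuterInv σ₀ σ p f)
    (hp : p < σ₀.ireg 2) {j : ℕ} (hj : j ≤ σ₀.ireg 3) :
    InnerInv σ₀ ((step sketchProgram)^[15 * j + 10] σ) p j
      (fun x => f x + ∑ i ∈ Finset.range j,
        if targetCell σ₀ p i = x then contribution σ₀ p i else 0) := by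
  induction j with
  | zero => simpa using H.enter hp
  | succ j ih =>
    have h := (ih (by omega)).next (by omega)
    rw [← Function.iterate_add_apply] at h
    convert h using 1
    · congr 1; omega
    · ext x; rw [Finset.sum_range_succ, add_assoc]

lemma OuterInv.next {σ₀ σ : State} {p : ℕ} {f : ℕ → ℝ} (H : OuterInv σ₀ σ p f)
    (hp : p < σ₀.ireg 2) :
    OuterInv σ₀ ((step sketchProgram)^[15 * σ₀.ireg 3 + 12] σ) (p + 1)
      (fun x => f x + ∑ i ∈ Finset.range (σ₀.ireg 3),
        if targetCell σ₀ p i = x then contribution σ₀ p i else 0) := by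
  have h := (H.inner hp le_rfl).exit
  rw [← Function.iterate_add_apply] at h
  convert h using 2
  omega

lemma outerInv_of_le {σ₀ σ : State} (H : OuterInv σ₀ σ 0 0) {p : ℕ} (hp : p ≤ σ₀.ireg 2) :
    OuterInv σ₀ ((step sketchProgram)^[p * (15 * σ₀.ireg 3 + 12)] σ) p
      (fun x => ∑ l ∈ Finset.range p, ∑ i ∈ Finset.range (σ₀.ireg 3),
        if targetCell σ₀ l i = x then contribution σ₀ l i else 0) := by
  induction p with
  | zero => simpa [Pi.zero_def] using H
  | succ p ih =>
    have h := (ih (by omega)).next (by omega)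
    rw [← Function.iterate_add_apply] at h
    convert h using 1
    · congr 1; ring
    · ext x; rw [Finset.sum_range_succ]

/-- The program halts after a number of steps linear in the number of (entry, embedding) pairs,
with the sum of all contributions in the output array. -/
lemma sketchProgram_halts (σ₀ : State) (hpc : σ₀.pc = 0) (h6 : σ₀.ireg 6 = 0)
    (hout : σ₀.rarr 2 = 0) :
    ∃ τ, HaltsIn sketchProgram σ₀ (σ₀.ireg 2 * (15 * σ₀.ireg 3 + 12) + 3) τ ∧
      τ.rarr 2 = fun x => ∑ l ∈ Finset.range (σ₀.ireg 2), ∑ i ∈ Finset.range (σ₀.ireg 3),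
        if targetCell σ₀ l i = x then contribution σ₀ l i else 0 := by
  have H0 : OuterInv σ₀ (step sketchProgram σ₀) 0 0 := by
    have e : step sketchProgram σ₀ = σ₀.setI 7 1 := by
      simp [step, hpc, sketchProgram, exec]
    rw [e]
    constructor
    · constructor <;> simp [State.setI, hout]
    all_goals simp [State.setI, hpc, h6]
  have H := outerInv_of_le H0 le_rfl
  rw [← Function.iterate_succ_apply] at H
  refine ⟨_, ⟨rfl, ?_⟩, ?_⟩
  all_goals
    rw [show ∀ k, k + 3 = 2 + (k + 1) by intro k; omega, Function.iterate_add_apply]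
    revert H
    generalize (step sketchProgram)^[_] σ₀ = σ
    rintro ⟨⟨r1, r2, r3, r4, r7, s0, hi, a0, a1, out⟩, pc, r6⟩
    obtain ⟨c, ir, rr, ia, ra⟩ := σ
    simp only at *
    subst pc hi
    have hlt : ¬ ir 6 < ir 2 := by omega
    simp [Function.iterate_succ_apply, step, sketchProgram, exec, hlt]
  exact out

end RealRAM

/-- The entries of the generalized sparse embedding matrix. -/
lemma generalizedEmbedding_apply {n a v q : ℕ} (ω : EmbeddingSeed n a v q) (b : Fin q) (j : Fin a)
    (m : Fin v) (i : Fin n) :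
    generalizedEmbedding ω (b, j, m) i =
      if ω.1 i = b ∧ ω.2.1 j i = m then 1 / √(a : ℝ) * bitSign (ω.2.2 j i) else 0 := by
  by_cases hb : ω.1 i = b
  · subst hb
    simp [generalizedEmbedding, Matrix.blockDiagonal'_apply, Equiv.sigmaFiberEquiv,
      Equiv.sigmaEquivProd, bucketBlock, sparseJL, sparseEmbedding]
  · simp [generalizedEmbedding, Matrix.blockDiagonal'_apply, Equiv.sigmaFiberEquiv,
      Equiv.sigmaEquivProd, hb, Ne.symm hb]

namespace RealRAM

lemma mul_add_inj {x y k k' d : ℕ} (hk : k < d) (hk' : k' < d) :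
    x * d + k = y * d + k' ↔ x = y ∧ k = k' := by
  refine ⟨fun h => ?_, by rintro ⟨rfl, rfl⟩; rfl⟩
  have h2 : k = k' := by
    simpa [Nat.add_mod, Nat.mod_eq_of_lt hk, Nat.mod_eq_of_lt hk'] using congrArg (· % d) h
  subst h2
  exact ⟨Nat.eq_of_mul_eq_mul_right (by omega) (Nat.add_right_cancel h), rfl⟩

lemma tableOf_apply {α : Type*} [Zero α] {m m' : ℕ} (f : Fin m → Fin m' → α) (x : Fin m)
    (y : Fin m') : tableOf f (x * m' + y) = f x y := by
  have h : (x : ℕ) * m' + y = (finProdFinEquiv (x, y) : Fin (m * m')) := by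
    simp [finProdFinEquiv, mul_comm, add_comm]
  rw [h, tableOf, arrayOf, dif_pos (Fin.is_lt _)]
  simp only [Fin.eta, Equiv.symm_apply_apply]

lemma arrayOf_apply {α : Type*} [Zero α] {m : ℕ} (f : Fin m → α) (x : Fin m) :
    arrayOf f x = f x := by
  simp [arrayOf]

lemma sum_nonzeroPos {n d : ℕ} (A : Matrix (Fin n) (Fin d) ℝ) (e : Fin (nnz A) ≃ NonzeroPos A)
    (k : Fin d) (c : Fin n → ℝ) :
    ∑ p, (if (e p).1.2 = k then c (e p).1.1 * A (e p).1.1 (e p).1.2 else 0) =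
      ∑ i, c i * A i k := by
  classical
  rw [Equiv.sum_comp e (fun P : NonzeroPos A =>
    if P.1.2 = k then c P.1.1 * A P.1.1 P.1.2 else 0),
    ← Finset.sum_subtype (Finset.univ.filter fun P : Fin n × Fin d => A P.1 P.2 ≠ 0) (by simp)
      (fun P => if P.2 = k then c P.1 * A P.1 P.2 else 0),
    Finset.sum_filter_of_ne (by rintro P - h h0; simp [h0] at h), Fintype.sum_prod_type]
  simp

/-- The program computes `S * A` in `O(nnz(A) * a)` steps. -/
theorem sketchProgram_spec {n d a v q : ℕ} (A : Matrix (Fin n) (Fin d) ℝ)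
    (ω : EmbeddingSeed n a v q) (e : Fin (nnz A) ≃ NonzeroPos A) :
    ∃ τ, HaltsIn sketchProgram (initial A e ω) (nnz A * (15 * a + 12) + 3) τ ∧
      Outputs τ (generalizedEmbedding ω * A) := by
  obtain ⟨τ, hτ, hout⟩ := sketchProgram_halts (initial A e ω) rfl (by simp [initial, arrayOf])
    rfl
  have i1 : (initial A e ω).ireg 1 = d := by simp [initial, arrayOf]
  have i2 : (initial A e ω).ireg 2 = nnz A := by simp [initial, arrayOf]
  have i3 : (initial A e ω).ireg 3 = a := by simp [initial, arrayOf]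
  have i4 : (initial A e ω).ireg 4 = v := by simp [initial, arrayOf]
  rw [i2, i3] at hτ hout
  refine ⟨τ, hτ, fun b j m k => ?_⟩
  rw [hout]
  simp only [Finset.sum_range, Matrix.mul_apply]
  rw [← sum_nonzeroPos A e k]
  refine Finset.sum_congr rfl fun p _ => ?_
  have e0 : (initial A e ω).iarr 0 p = (e p).1.1 :=
    arrayOf_apply (fun p => ((e p).1.1 : ℕ)) p
  have e1 : (initial A e ω).iarr 1 p = (e p).1.2 :=
    arrayOf_apply (fun p => ((e p).1.2 : ℕ)) p
  have e2 : (initial A e ω).iarr 2 (e p).1.1 = ω.1 (e p).1.1 :=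
    arrayOf_apply (fun i => (ω.1 i : ℕ)) _
  have e3 : ∀ j : Fin a, (initial A e ω).iarr 3 ((e p).1.1 * a + j) = ω.2.1 j (e p).1.1 :=
    fun j => tableOf_apply (fun i j => (ω.2.1 j i : ℕ)) _ j
  have e4 : ∀ j : Fin a, (initial A e ω).rarr 1 ((e p).1.1 * a + j) =
      bitSign (ω.2.2 j (e p).1.1) :=
    fun j => tableOf_apply (fun i j => bitSign (ω.2.2 j i)) _ j
  have e5 : (initial A e ω).rarr 0 p = A (e p).1.1 (e p).1.2 :=
    arrayOf_apply (fun p => A (e p).1.1 (e p).1.2) p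
  have e6 : (initial A e ω).rreg 0 = 1 / √(a : ℝ) := by simp [initial, arrayOf]
  simp only [targetCell, contribution, e0, e1, e2, i1, i3, i4, e3, e4, e5, e6,
    mul_add_inj (Fin.is_lt _) (Fin.is_lt _), Fin.val_inj, generalizedEmbedding_apply]
  rw [Finset.sum_eq_single j]
  · by_cases h1 : (e p).1.2 = k <;> by_cases h2 : ω.1 (e p).1.1 = b <;>
      by_cases h3 : ω.2.1 j (e p).1.1 = m <;> simp [h1, h2, h3]
    ring
  · intro j' _ hj
    simp [hj]
  · simp

end RealRAM

/-! ### Exponential moments of Rademacher chaoses -/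


/-- The indicator function of an event; its average over a finite type is the probability of the
event under the uniform distribution. -/
def ind {Ω : Type*} (S : Set Ω) : Ω → ℝ := S.indicator 1

section Ind

variable {Ω : Type*} {S T : Set Ω} {ω : Ω}

lemma ind_of_mem (h : ω ∈ S) : ind S ω = 1 := Set.indicator_of_mem h _

lemma ind_of_notMem (h : ω ∉ S) : ind S ω = 0 := Set.indicator_of_notMem h _

lemma ind_nonneg (S : Set Ω) (ω : Ω) : 0 ≤ ind S ω :=
  Set.indicator_nonneg (fun _ _ => zero_le_one) _

lemma ind_le_one (S : Set Ω) (ω : Ω) : ind S ω ≤ 1 :=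
  Set.indicator_le_self' (f := 1) (fun _ _ => zero_le_one) ω

lemma ind_le {c : ℝ} (hc : 0 ≤ c) (h : ω ∈ S → 1 ≤ c) : ind S ω ≤ c :=
  Set.indicator_apply_le' h fun _ => hc

lemma ind_le_sum {ι : Type*} {N : Finset ι} {F : ι → Set Ω}
    (h : ω ∈ S → ∃ x ∈ N, ω ∈ F x) : ind S ω ≤ ∑ x ∈ N, ind (F x) ω := by
  refine ind_le (Finset.sum_nonneg fun x _ => ind_nonneg _ _) fun hω => ?_
  obtain ⟨x, hx, hxω⟩ := h hω
  exact (ind_of_mem hxω).symm.le.trans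
    (Finset.single_le_sum (f := fun x => ind (F x) ω) (fun x _ => ind_nonneg _ _) hx)

end Ind

section Chaos

variable {α κ : Type*} [DecidableEq κ]

/-- The squared mass `∑ y i ^ 2` of the coordinates of `I` that lie in the cell `k`. -/
def cellMass (c : α → κ) (y : α → ℝ) (I : Finset α) (k : κ) : ℝ :=
  ∑ i ∈ I, if c i = k then y i ^ 2 else 0

/-- The off-diagonal part `∑ y i ^ 2 * y i' ^ 2`, over `i ≠ i'` in `I` and in the cell `k`, of
`cellMass c y I k ^ 2`. -/
def pairMass (c : α → κ) (y : α → ℝ) (I : Finset α) (k : κ) : ℝ :=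
  cellMass c y I k ^ 2 - ∑ i ∈ I, if c i = k then y i ^ 4 else 0

/-- The signed sum of the coordinates of `I` that lie in the cell `k`. -/
def cellSum (c : α → κ) (y : α → ℝ) (s : α → Bool) (I : Finset α) (k : κ) : ℝ :=
  ∑ i ∈ I, if c i = k then bitSign (s i) * y i else 0

lemma cellMass_nonneg (c : α → κ) (y : α → ℝ) (I : Finset α) (k : κ) : 0 ≤ cellMass c y I k :=
  Finset.sum_nonneg fun i _ => by split_ifs <;> positivity

lemma cellMass_mono (c : α → κ) (y : α → ℝ) {I J : Finset α} (h : I ⊆ J) (k : κ) :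
    cellMass c y I k ≤ cellMass c y J k :=
  Finset.sum_le_sum_of_subset_of_nonneg h fun i _ _ => by split_ifs <;> positivity

lemma bitSign_sq (b : Bool) : bitSign b ^ 2 = 1 := by cases b <;> simp [bitSign]

/-- Averaging first over one coordinate leaves a uniform average unchanged. -/
lemma expect_eq_expect_update {X : Type*} [Fintype α] [DecidableEq α] [Fintype X] [Nonempty X]
    (i : α) (f : (α → X) → ℝ) : (𝔼 s, f s) = 𝔼 s, 𝔼 x, f (Function.update s i x) := by
  -- Exchanging the coordinate `i` with an independent copy is an involution.
  have hinv : Function.Involutive fun p : (α → X) × X => (Function.update p.1 i p.2, p.1 i) :=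
    fun p => by simp
  have h := Fintype.expect_bijective _ hinv.bijective
    (fun p : (α → X) × X => f (Function.update p.1 i p.2)) (fun p => f p.1) fun p => rfl
  rw [← Finset.univ_product_univ, Finset.expect_product, Finset.expect_product] at h
  simpa using h.symm

/-- One averaging step: the coefficient of `z * y` in the exponent is `2λ + 8λ²M`, and
`(2λ + 8λ²M)² / 2 ≤ 4λ²` because `|λ| M ≤ 1/10`. -/
lemma exp_average_le {l M : ℝ} (hM : 0 ≤ M) (hl : |l| * M ≤ 1 / 10) (y z : ℝ) :
    (Real.exp (2 * l * y * z + 4 * l ^ 2 * M * (2 * z * y + y ^ 2)) +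
      Real.exp (-(2 * l * y * z) + 4 * l ^ 2 * M * (-(2 * z * y) + y ^ 2))) / 2 ≤
      Real.exp (4 * l ^ 2 * y ^ 2 * M + 4 * l ^ 2 * z ^ 2 * y ^ 2) := by
  have h1 : (Real.exp (2 * l * y * z + 4 * l ^ 2 * M * (2 * z * y + y ^ 2)) +
      Real.exp (-(2 * l * y * z) + 4 * l ^ 2 * M * (-(2 * z * y) + y ^ 2))) / 2 =
      Real.exp (4 * l ^ 2 * y ^ 2 * M) * Real.cosh ((2 * l + 8 * l ^ 2 * M) * y * z) := by
    rw [Real.cosh_eq, mul_div_assoc', mul_add (Real.exp _), ← Real.exp_add, ← Real.exp_add]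
    congr 3 <;> ring
  rw [h1, Real.exp_add]
  gcongr
  refine (Real.cosh_le_exp_half_sq _).trans (Real.exp_le_exp.2 ?_)
  have h2 : (1 + 4 * (l * M)) ^ 2 ≤ 2 := by
    rw [← abs_of_nonneg hM, ← abs_mul, abs_le] at hl
    nlinarith
  have h3 : ((2 * l + 8 * l ^ 2 * M) * y * z) ^ 2 / 2 =
    2 * (l * y * z) ^ 2 * (1 + 4 * (l * M)) ^ 2 := by ring
  rw [h3]
  nlinarith [sq_nonneg (l * y * z)]

/-- The exponential moment of a Rademacher chaos that is a sum over cells, relative to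
coordinates outside `I`, whose signs enter through `z` and the weight `φ` only. The signs are
averaged out one at a time. -/
theorem expect_exp_chaos_le [Fintype α] [DecidableEq α] [Fintype κ] (c : α → κ) (y : α → ℝ) {l : ℝ}
    (I : Finset α) (hl : ∀ k, |l| * cellMass c y I k ≤ 1 / 10)
    (φ : (α → Bool) → ℝ) (hφ : ∀ s, 0 ≤ φ s) (z : (α → Bool) → κ → ℝ)
    (hφI : ∀ s t, (∀ i ∉ I, s i = t i) → φ s = φ t)
    (hzI : ∀ s t, (∀ i ∉ I, s i = t i) → z s = z t) :
    (𝔼 s, φ s * Real.exp (l * ∑ k,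
      ((z s k + cellSum c y s I k) ^ 2 - z s k ^ 2 - cellMass c y I k))) ≤
    𝔼 s, φ s * Real.exp (2 * l ^ 2 * ∑ k,
      (pairMass c y I k + 2 * z s k ^ 2 * cellMass c y I k)) := by
  induction I using Finset.induction_on generalizing φ z with
  | empty => simp [cellSum, cellMass, pairMass]
  | insert i I hi ih =>
    have hmass : ∀ k, cellMass c y (insert i I) k =
        (if c i = k then y i ^ 2 else 0) + cellMass c y I k := fun k => Finset.sum_insert hi
    have hsum : ∀ s k, cellSum c y s (insert i I) k =
        (if c i = k then bitSign (s i) * y i else 0) + cellSum c y s I k :=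
      fun s k => Finset.sum_insert hi
    have hpair : ∀ k, pairMass c y (insert i I) k =
        pairMass c y I k + if c i = k then 2 * y i ^ 2 * cellMass c y I k else 0 := fun k => by
      rw [pairMass, pairMass, hmass, Finset.sum_insert hi]
      split_ifs <;> ring
    have hlI : ∀ k, |l| * cellMass c y I k ≤ 1 / 10 := fun k =>
      (mul_le_mul_of_nonneg_left (cellMass_mono c y (Finset.subset_insert i I) k)
        (abs_nonneg l)).trans (hl k)
    have hne : ∀ {s t : α → Bool}, (∀ j ∉ I, s j = t j) → ∀ j ∉ insert i I, s j = t j :=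
      fun h j hj => h j fun hj' => hj (Finset.mem_insert_of_mem hj')
    -- The sign of `i` joins the frozen part.
    have := ih hlI (fun s => φ s * Real.exp (2 * l * (bitSign (s i) * y i) * z s (c i)))
      (fun s => mul_nonneg (hφ s) (Real.exp_nonneg _))
      (fun s k => z s k + if c i = k then bitSign (s i) * y i else 0)
      (fun s t h => by
        rw [hφI s t (hne h), hzI s t (hne h), h i hi])
      (fun s t h => by
        rw [hzI s t (hne h), h i hi])
    refine le_trans (le_of_eq (Finset.expect_congr rfl fun s _ => ?_)) (this.trans ?_)
    · rw [mul_assoc, ← Real.exp_add]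
      congr 2
      have : ∀ k, (z s k + cellSum c y s (insert i I) k) ^ 2 - z s k ^ 2 -
          cellMass c y (insert i I) k =
          (((z s k + if c i = k then bitSign (s i) * y i else 0) + cellSum c y s I k) ^ 2 -
          (z s k + if c i = k then bitSign (s i) * y i else 0) ^ 2 - cellMass c y I k) +
          if c i = k then 2 * (bitSign (s i) * y i) * z s k else 0 := fun k => by
        rw [hsum, hmass]
        split_ifs
        · linear_combination y i ^ 2 * bitSign_sq (s i)
        · ring
      simp only [this, Finset.sum_add_distrib, Finset.sum_ite_eq, Finset.mem_univ, if_true]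
      ring
    · rw [expect_eq_expect_update i]
      refine Finset.expect_le_expect fun s _ => ?_
      rw [Fintype.expect_eq_sum_div_card, Fintype.sum_bool, Fintype.card_bool, Nat.cast_ofNat]
      have hu : ∀ b, φ (Function.update s i b) = φ s := fun b => hφI _ _ fun j hj =>
        Function.update_of_ne (by rintro rfl; exact hj (Finset.mem_insert_self _ _)) _ _
      have hz : ∀ b, z (Function.update s i b) = z s := fun b => hzI _ _ fun j hj =>
        Function.update_of_ne (by rintro rfl; exact hj (Finset.mem_insert_self _ _)) _ _
      simp only [hu, hz, Function.update_self]
      have e1 : ∀ b, ∑ k, (pairMass c y I k +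
          2 * (z s k + if c i = k then bitSign b * y i else 0) ^ 2 * cellMass c y I k) =
          ∑ k, (pairMass c y I k + 2 * z s k ^ 2 * cellMass c y I k) +
          2 * cellMass c y I (c i) * (2 * z s (c i) * (bitSign b * y i) + y i ^ 2) := fun b => by
        have : ∀ k, pairMass c y I k +
          2 * (z s k + if c i = k then bitSign b * y i else 0) ^ 2 * cellMass c y I k =
          (pairMass c y I k + 2 * z s k ^ 2 * cellMass c y I k) + if c i = k then
            2 * cellMass c y I k * (2 * z s k * (bitSign b * y i) + y i ^ 2) else 0 := fun k => by
          split_ifs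
          · linear_combination 2 * cellMass c y I k * y i ^ 2 * bitSign_sq b
          · ring
        simp only [this, Finset.sum_add_distrib, Finset.sum_ite_eq, Finset.mem_univ, if_true]
      have e2 : ∑ k, (pairMass c y (insert i I) k + 2 * z s k ^ 2 * cellMass c y (insert i I) k) =
          ∑ k, (pairMass c y I k + 2 * z s k ^ 2 * cellMass c y I k) +
          (2 * y i ^ 2 * cellMass c y I (c i) + 2 * z s (c i) ^ 2 * y i ^ 2) := by
        have : ∀ k, pairMass c y (insert i I) k + 2 * z s k ^ 2 * cellMass c y (insert i I) k =
          (pairMass c y I k + 2 * z s k ^ 2 * cellMass c y I k) + if c i = k then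
            2 * y i ^ 2 * cellMass c y I k + 2 * z s k ^ 2 * y i ^ 2 else 0 := fun k => by
          rw [hpair, hmass]; split_ifs <;> ring
        simp only [this, Finset.sum_add_distrib, Finset.sum_ite_eq, Finset.mem_univ, if_true]
      rw [e1, e1, e2]
      generalize ∑ k, (pairMass c y I k + 2 * z s k ^ 2 * cellMass c y I k) = B
      have h3 := mul_le_mul_of_nonneg_left
        (exp_average_le (cellMass_nonneg c y I (c i)) (hlI (c i)) (y i) (z s (c i)))
        (mul_nonneg (hφ s) (Real.exp_nonneg (2 * l ^ 2 * B)))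
      refine le_trans (le_of_eq ?_) (h3.trans (le_of_eq ?_))
      · simp only [bitSign, if_true, Bool.false_eq_true, if_false]
        have f : ∀ u w, φ s * Real.exp u * Real.exp w = φ s * Real.exp (u + w) := fun u w => by
          rw [Real.exp_add, mul_assoc]
        have g : ∀ u w t, φ s * Real.exp t * ((Real.exp u + Real.exp w) / 2) =
            (φ s * Real.exp (t + u) + φ s * Real.exp (t + w)) / 2 := fun u w t => by
          rw [Real.exp_add, Real.exp_add]; ring
        rw [f, f, g]
        congr 4 <;> ring_nf
      · rw [mul_assoc, ← Real.exp_add]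
        congr 2
        ring

/-- The tail bound that the exponential moment gives, on the part of the probability space where
the weight `φ` does not vanish. -/
theorem expect_chaos_tail_le [Fintype α] [DecidableEq α] [Fintype κ] (c : α → κ) (y : α → ℝ)
    {l W Q : ℝ} (t : ℝ) (I : Finset α) (hl : 0 ≤ l) (hlW : l * W ≤ 1 / 10)
    (hW : ∀ k, cellMass c y I k ≤ W) (φ : (α → Bool) → ℝ) (hφ : ∀ s, 0 ≤ φ s)
    (hφ1 : ∀ s, φ s ≤ 1) (z : (α → Bool) → κ → ℝ)
    (hφI : ∀ s t, (∀ i ∉ I, s i = t i) → φ s = φ t)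
    (hzI : ∀ s t, (∀ i ∉ I, s i = t i) → z s = z t)
    (hQ : ∀ s, φ s ≠ 0 → ∑ k, (pairMass c y I k + 2 * z s k ^ 2 * cellMass c y I k) ≤ Q) :
    (𝔼 s, φ s * ind {s | t < |∑ k,
      ((z s k + cellSum c y s I k) ^ 2 - z s k ^ 2 - cellMass c y I k)|} s) ≤
    2 * Real.exp (-(l * t) + 2 * l ^ 2 * Q) := by
  have hlM : ∀ k, l * cellMass c y I k ≤ 1 / 10 := fun k =>
    (mul_le_mul_of_nonneg_left (hW k) hl).trans hlW
  have h1 := expect_exp_chaos_le c y I (l := l) (by simpa [abs_of_nonneg hl] using hlM)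
    φ hφ z hφI hzI
  have h2 := expect_exp_chaos_le c y I (l := -l) (by simpa [abs_of_nonneg hl] using hlM)
    φ hφ z hφI hzI
  have h3 : ∀ m : ℝ, m ^ 2 = l ^ 2 → (𝔼 s, φ s * Real.exp (2 * m ^ 2 * ∑ k,
      (pairMass c y I k + 2 * z s k ^ 2 * cellMass c y I k))) ≤ Real.exp (2 * l ^ 2 * Q) := by
    intro m hm
    rw [hm]
    refine Finset.expect_le Finset.univ_nonempty fun s _ => ?_
    by_cases h0 : φ s = 0
    · rw [h0, zero_mul]; positivity
    · calc _ ≤ 1 * Real.exp (2 * l ^ 2 * Q) := by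
            gcongr
            exacts [hφ1 s, hQ s h0]
        _ = _ := one_mul _
  set D : (α → Bool) → ℝ := fun s => ∑ k,
    ((z s k + cellSum c y s I k) ^ 2 - z s k ^ 2 - cellMass c y I k) with hD
  have hmarkov : ∀ s, φ s * ind {s | t < |D s|} s ≤
      Real.exp (-(l * t)) * (φ s * Real.exp (l * D s)) +
      Real.exp (-(l * t)) * (φ s * Real.exp (-l * D s)) := by
    intro s
    have e : Real.exp (-(l * t)) * (φ s * Real.exp (l * D s)) +
        Real.exp (-(l * t)) * (φ s * Real.exp (-l * D s)) =
        φ s * (Real.exp (-(l * t) + l * D s) + Real.exp (-(l * t) + -l * D s)) := by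
      rw [Real.exp_add, Real.exp_add]; ring
    rw [e]
    refine mul_le_mul_of_nonneg_left ?_ (hφ s)
    refine ind_le (by positivity) fun hs => ?_
    rcases lt_abs.1 (show t < |D s| from hs) with hs | hs
    · have : 1 ≤ Real.exp (-(l * t) + l * D s) :=
        Real.one_le_exp (by nlinarith)
      exact this.trans (le_add_of_nonneg_right (Real.exp_nonneg _))
    · have : 1 ≤ Real.exp (-(l * t) + -l * D s) :=
        Real.one_le_exp (by nlinarith)
      exact this.trans (le_add_of_nonneg_left (Real.exp_nonneg _))
  refine (Finset.expect_le_expect fun s _ => hmarkov s).trans ?_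
  rw [Finset.expect_add_distrib, ← Finset.mul_expect, ← Finset.mul_expect, Real.exp_add]
  have h4 := mul_le_mul_of_nonneg_left (h1.trans (h3 l rfl)) (Real.exp_nonneg (-(l * t)))
  have h5 := mul_le_mul_of_nonneg_left (h2.trans (h3 (-l) (by ring))) (Real.exp_nonneg (-(l * t)))
  linarith

/-- The off-diagonal squared masses, as a sum over pairs of distinct coordinates in one cell. -/
lemma sum_pairMass [Fintype κ] [DecidableEq α] (c : α → κ) (y : α → ℝ) (I : Finset α) :
    ∑ k, pairMass c y I k =
      ∑ i ∈ I, ∑ i' ∈ I, if c i = c i' ∧ i ≠ i' then y i ^ 2 * y i' ^ 2 else 0 := by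
  have h : ∀ k, pairMass c y I k = ∑ i ∈ I, ∑ i' ∈ I,
      if c i = k then (if c i = c i' ∧ i ≠ i' then y i ^ 2 * y i' ^ 2 else 0) else 0 := by
    intro k
    have h4 : ∑ i ∈ I, (if c i = k then y i ^ 4 else 0) = ∑ i ∈ I, ∑ i' ∈ I,
        if i = i' then (if c i = k then y i ^ 4 else 0) else 0 :=
      Finset.sum_congr rfl fun i hi => by rw [Finset.sum_ite_eq, if_pos hi]
    rw [pairMass, cellMass, sq, Finset.sum_mul_sum, h4, ← Finset.sum_sub_distrib]
    refine Finset.sum_congr rfl fun i _ => ?_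
    rw [← Finset.sum_sub_distrib]
    refine Finset.sum_congr rfl fun i' _ => ?_
    by_cases h1 : c i = k
    · by_cases h2 : i = i'
      · subst h2; simp [h1]; ring
      · simp [h1, h2, eq_comm]
    · simp [h1]
  simp only [h]
  rw [Finset.sum_comm]
  refine Finset.sum_congr rfl fun i _ => ?_
  rw [Finset.sum_comm]
  simp

end Chaos

/-! ### Nets for quadratic forms -/

/-- A finite-dimensional unit ball has a `1/2`-net of at most `5 ^ dim` points; approximating the
remainder by a second such net gives a `1/4`-net, and this is fine enough to control a quadratic
form. -/
theorem exists_quadratic_net_univ (E : Type*) [NormedAddCommGroup E] [InnerProductSpace ℝ E]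
    [FiniteDimensional ℝ E] :
    ∃ N : Finset E, (∀ x ∈ N, ‖x‖ ≤ 3 / 2) ∧ N.card ≤ 25 ^ Module.finrank ℝ E ∧
      ∀ (B : LinearMap.BilinForm ℝ E) (η : ℝ), (∀ x ∈ N, |B x x| ≤ η) →
        ∀ y, |B y y| ≤ 3 * η * ‖y‖ ^ 2 := by
  classical
  let P : ℕ → Prop := fun k => ∃ s : Finset E, (∀ c ∈ s, ‖c‖ ≤ 2) ∧
    (∀ c ∈ s, ∀ d ∈ s, c ≠ d → 1 ≤ ‖c - d‖) ∧ s.card = k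
  have hP0 : P 0 := ⟨∅, by simp⟩
  have hPle : ∀ k, P k → k ≤ 5 ^ Module.finrank ℝ E := by
    rintro k ⟨s, h1, h2, rfl⟩
    exact Besicovitch.card_le_of_separated s h1 h2
  obtain ⟨s, hs1, hs2, hs3⟩ : P (Nat.findGreatest P (5 ^ Module.finrank ℝ E)) :=
    Nat.findGreatest_spec (Nat.zero_le _) hP0
  -- By maximality, every point of the ball is close to a point of `s`.
  have hcover : ∀ y : E, ‖y‖ ≤ 2 → ∃ p ∈ s, ‖y - p‖ ≤ 1 := by
    intro y hy
    by_contra! hfar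
    have hy' : y ∉ s := fun h => by simpa using (hfar y h).le.trans_lt' one_pos
    have hP : P (s.card + 1) := by
      refine ⟨insert y s, ?_, ?_, Finset.card_insert_of_notMem hy'⟩
      · intro c hc
        rcases Finset.mem_insert.1 hc with rfl | hc
        exacts [hy, hs1 c hc]
      · intro c hc d hd hcd
        rcases Finset.mem_insert.1 hc with h1 | h1 <;> rcases Finset.mem_insert.1 hd with h2 | h2
        · exact absurd (h1.trans h2.symm) hcd
        · rw [h1]; exact (hfar d h2).le
        · rw [h2, norm_sub_rev]; exact (hfar c h1).le
        · exact hs2 c h1 d h2 hcd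
    have := Nat.le_findGreatest (hPle _ hP) hP
    omega
  let N : Finset E := (s ×ˢ s).image fun p => (1 / 2 : ℝ) • p.1 + (1 / 4 : ℝ) • p.2
  have hNnorm : ∀ x ∈ N, ‖x‖ ≤ 3 / 2 := by
    intro x hx
    obtain ⟨⟨p, p'⟩, hp, rfl⟩ := Finset.mem_image.1 hx
    rw [Finset.mem_product] at hp
    refine (norm_add_le _ _).trans ?_
    rw [norm_smul, norm_smul]
    have h1 := hs1 p hp.1
    have h2 := hs1 p' hp.2
    norm_num
    linarith
  have hNnear : ∀ y : E, ‖y‖ ≤ 1 → ∃ x ∈ N, ‖y - x‖ ≤ 1 / 4 := by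
    intro y hy
    obtain ⟨p, hp, h1⟩ := hcover ((2 : ℝ) • y) (by rw [norm_smul]; norm_num; linarith)
    obtain ⟨p', hp', h2⟩ := hcover ((2 : ℝ) • ((2 : ℝ) • y - p))
      (by rw [norm_smul]; norm_num; linarith)
    refine ⟨_, Finset.mem_image.2 ⟨(p, p'), Finset.mem_product.2 ⟨hp, hp'⟩, rfl⟩, ?_⟩
    have : y - ((1 / 2 : ℝ) • p + (1 / 4 : ℝ) • p') =
        (1 / 4 : ℝ) • ((2 : ℝ) • ((2 : ℝ) • y - p) - p') := by module
    simp only [this, norm_smul]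
    norm_num
    linarith
  refine ⟨N, hNnorm, ?_, ?_⟩
  · refine Finset.card_image_le.trans ?_
    rw [Finset.card_product, show (25 : ℕ) = 5 * 5 by norm_num, mul_pow]
    exact Nat.mul_le_mul (hs3 ▸ Nat.findGreatest_le _) (hs3 ▸ Nat.findGreatest_le _)
  · intro B η hη
    -- `K` is the largest value of the form on the unit ball.
    have hcont : Continuous fun y : E => |B y y| := by
      have : Continuous fun y : E => LinearMap.toContinuousBilinearMap B y y := by fun_prop
      exact this.abs
    obtain ⟨y₀, hy₀, hmax⟩ := (isCompact_closedBall (0 : E) 1).exists_isMaxOn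
      ⟨0, by simp⟩ hcont.continuousOn
    have hball : ∀ y : E, ‖y‖ ≤ 1 → |B y y| ≤ |B y₀ y₀| := fun y hy =>
      hmax (by simpa using hy)
    have hsq : ∀ y : E, |B y y| ≤ |B y₀ y₀| * ‖y‖ ^ 2 := by
      intro y
      rcases eq_or_ne y 0 with rfl | hy
      · simp
      have hy' : 0 < ‖y‖ := norm_pos_iff.2 hy
      have h := hball (‖y‖⁻¹ • y) (by rw [norm_smul]; simp [hy'.ne'])
      simp only [map_smul, LinearMap.smul_apply, smul_eq_mul, abs_mul, abs_inv, abs_norm] at h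
      calc |B y y| = ‖y‖ ^ 2 * (‖y‖⁻¹ * (‖y‖⁻¹ * |B y y|)) := by field_simp
        _ ≤ ‖y‖ ^ 2 * |B y₀ y₀| := by gcongr
        _ = _ := mul_comm _ _
    obtain ⟨x, hx, hxy⟩ := hNnear y₀ (by simpa using hy₀)
    have hy1 : ‖y₀‖ ≤ 1 := by simpa using hy₀
    -- Polarization, with the two arguments rescaled to norm at most `3/4`.
    have hdiff : |B y₀ y₀ - B x x| ≤ 9 / 16 * |B y₀ y₀| := by
      set u : E := (3 : ℝ) • (y₀ - x) with hu
      set w : E := (1 / 3 : ℝ) • (y₀ + x) with hw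
      have hun : ‖u‖ ≤ 3 / 4 := by rw [hu, norm_smul]; norm_num; linarith
      have hwn : ‖w‖ ≤ 3 / 4 := by
        have h1 : y₀ + x = (2 : ℝ) • y₀ - (y₀ - x) := by module
        have h2 : ‖y₀ + x‖ ≤ 9 / 4 := by
          rw [h1]
          refine (norm_sub_le _ _).trans ?_
          rw [norm_smul]; norm_num; linarith
        rw [hw, norm_smul]; norm_num; linarith
      have e : B y₀ y₀ - B x x = (B (u + w) (u + w) - B (u - w) (u - w)) / 4 := by
        simp only [hu, hw, map_add, map_sub, map_smul, LinearMap.add_apply, LinearMap.sub_apply,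
          LinearMap.smul_apply, smul_eq_mul]
        ring
      have hpar := parallelogram_law_with_norm ℝ u w
      have h1 := abs_le.1 (hsq (u + w))
      have h2 := abs_le.1 (hsq (u - w))
      have h3 : ‖u + w‖ ^ 2 + ‖u - w‖ ^ 2 ≤ 9 / 4 := by nlinarith [norm_nonneg u, norm_nonneg w]
      have h4 := mul_le_mul_of_nonneg_left h3 (abs_nonneg (B y₀ y₀))
      rw [e, abs_le]
      constructor <;> linarith [h1.1, h1.2, h2.1, h2.2]
    have hK : |B y₀ y₀| ≤ 3 * η := by
      have h1 := hη x hx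
      have h2 := abs_sub_abs_le_abs_sub (B y₀ y₀) (B x x)
      have h3 := abs_nonneg (B x x)
      linarith
    intro y
    exact (hsq y).trans (by gcongr)

/-- The net of a subspace `V`; the form need only be small on points of `V`. -/
theorem exists_quadratic_net {E : Type*} [NormedAddCommGroup E] [InnerProductSpace ℝ E]
    [FiniteDimensional ℝ E] (V : Submodule ℝ E) :
    ∃ N : Finset E, (∀ x ∈ N, x ∈ V ∧ ‖x‖ ≤ 3 / 2) ∧ N.card ≤ 25 ^ Module.finrank ℝ V ∧
      ∀ (B : LinearMap.BilinForm ℝ E) (η : ℝ), (∀ x ∈ N, |B x x| ≤ η) →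
        ∀ y ∈ V, |B y y| ≤ 3 * η * ‖y‖ ^ 2 := by
  classical
  obtain ⟨N, h1, h2, h3⟩ := exists_quadratic_net_univ V
  refine ⟨N.map (Function.Embedding.subtype _), ?_, by simpa using h2, fun B η hB y hy => ?_⟩
  · intro x hx
    obtain ⟨x, hx, rfl⟩ := Finset.mem_map.1 hx
    exact ⟨x.2, h1 x (by simpa using hx)⟩
  · exact h3 (B.comp V.subtype V.subtype) η
      (fun x hx => hB x (Finset.mem_map_of_mem _ hx)) ⟨y, hy⟩

/-! ### Leverage scores and bucket loads -/

/-- The leverage scores of a subspace: the squared row norms of an orthonormal basis. -/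
theorem exists_leverage {n : ℕ} (V : Submodule ℝ (EuclideanSpace ℝ (Fin n))) :
    ∃ u : Fin n → ℝ, (∀ i, 0 ≤ u i) ∧ ∑ i, u i = Module.finrank ℝ V ∧
      ∀ y ∈ V, ∀ i, y i ^ 2 ≤ u i * ‖y‖ ^ 2 := by
  let b := stdOrthonormalBasis ℝ V
  refine ⟨fun i => ∑ k, (b k : EuclideanSpace ℝ (Fin n)) i ^ 2, fun i => by positivity, ?_, ?_⟩
  · rw [Finset.sum_comm]
    have : ∀ k, ∑ i, (b k : EuclideanSpace ℝ (Fin n)) i ^ 2 = 1 := fun k => by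
      rw [← EuclideanSpace.real_norm_sq_eq, ← Submodule.coe_norm, b.orthonormal.1 k, one_pow]
    simp [this]
  · intro y hy i
    have h1 : y i = ∑ k, (b k : EuclideanSpace ℝ (Fin n)) i * b.repr ⟨y, hy⟩ k := by
      have := congrArg (fun z : V => (z : EuclideanSpace ℝ (Fin n)) i) (b.sum_repr ⟨y, hy⟩)
      simp only [Submodule.coe_sum, Submodule.coe_smul] at this
      rw [← this]
      simp [mul_comm]
    have h2 : ‖y‖ ^ 2 = ∑ k, b.repr ⟨y, hy⟩ k ^ 2 := by
      rw [← EuclideanSpace.real_norm_sq_eq, b.repr.norm_map]; rfl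
    rw [h1, h2]
    exact Finset.sum_mul_sq_le_sq_mul_sq _ _ _

/-- The average of a product of functions of separate coordinates. -/
lemma expect_prod_pi {ι X : Type*} [Fintype ι] [DecidableEq ι] [Fintype X] (F : ι → X → ℝ) :
    (𝔼 f : ι → X, ∏ i, F i (f i)) = ∏ i, 𝔼 x, F i x := by
  simp only [Fintype.expect_eq_sum_div_card, Finset.prod_div_distrib, Finset.prod_univ_sum,
    Fintype.piFinset_univ, Fintype.card_fun, Finset.prod_const, Finset.card_univ, Nat.cast_pow]

/-- A Chernoff bound: if weights in `[0, 1]` of sum at most `N` are thrown into `q` buckets, then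
it is unlikely that some bucket has a load above `k`. -/
theorem expect_bucket_load_le {n q k : ℕ} (w : Fin n → ℝ) (hw0 : ∀ i, 0 ≤ w i)
    (hw1 : ∀ i, w i ≤ 1) {N : ℝ} (hN0 : 0 < N) (hN : ∑ i, w i ≤ N) (hNq : N ≤ q) :
    (𝔼 h : Fin n → Fin q, ind
      {h | ∃ b, (k : ℝ) < ∑ i, if h i = b then w i else 0} h) ≤
      q * (Real.exp 1 * (N / q) ^ k) := by
  have hq : (0 : ℝ) < q := hN0.trans_le hNq
  have hc : 1 ≤ q / N := (one_le_div hN0).2 hNq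
  have hc0 : 0 < q / N := one_pos.trans_le hc
  have : Nonempty (Fin q) := ⟨⟨0, by exact_mod_cast hq⟩⟩
  have hbound : ∀ h : Fin n → Fin q, ind
      {h | ∃ b, (k : ℝ) < ∑ i, if h i = b then w i else 0} h ≤
      ∑ b, (N / q) ^ k * ∏ i, (if h i = b then (q / N) ^ w i else 1) := by
    intro h
    have hnn : ∀ b : Fin q, 0 ≤ (N / q) ^ k * ∏ i, (if h i = b then (q / N) ^ w i else 1) :=
      fun b => mul_nonneg (by positivity) (Finset.prod_nonneg fun i _ => by
        split_ifs <;> positivity)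
    refine ind_le (Finset.sum_nonneg fun b _ => hnn b) fun hh => ?_
    obtain ⟨b, hb⟩ := hh
    refine le_trans ?_ (Finset.single_le_sum (fun b _ => hnn b) (Finset.mem_univ b))
    have e : ∏ i, (if h i = b then (q / N) ^ w i else 1) =
        (q / N) ^ (∑ i, if h i = b then w i else 0) := by
      rw [Real.rpow_sum_of_pos hc0]
      exact Finset.prod_congr rfl fun i _ => by split_ifs <;> simp
    rw [e]
    have := Real.rpow_le_rpow_of_exponent_le hc hb.le
    rw [Real.rpow_natCast] at this
    calc (1 : ℝ) = (N / q) ^ k * (q / N) ^ k := by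
          rw [← mul_pow]; field_simp; simp
      _ ≤ _ := by gcongr
  have hprod : ∀ b : Fin q, (𝔼 h : Fin n → Fin q,
      ∏ i, (if h i = b then (q / N) ^ w i else 1)) ≤ Real.exp 1 := by
    intro b
    rw [expect_prod_pi (fun i x => if x = b then (q / N) ^ w i else 1)]
    have h1 : ∀ i, (𝔼 x : Fin q, if x = b then (q / N) ^ w i else 1) ≤
        Real.exp (w i / N) := by
      intro i
      have h2 : (𝔼 x : Fin q, if x = b then (q / N) ^ w i else (1 : ℝ)) =
          1 + ((q / N) ^ w i - 1) / q := by
        have : ∀ x : Fin q, (if x = b then (q / N) ^ w i else (1 : ℝ)) =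
            1 + if x = b then (q / N) ^ w i - 1 else 0 := fun x => by split_ifs <;> ring
        simp only [this, Finset.expect_add_distrib, Fintype.expect_const]
        rw [Fintype.expect_eq_sum_div_card]
        simp
      have h3 : (q / N) ^ w i ≤ 1 + w i * (q / N - 1) := by
        have := rpow_one_add_le_one_add_mul_self (s := q / N - 1) (by linarith) (hw0 i) (hw1 i)
        simpa using this
      rw [h2]
      have h4 : ((q / N) ^ w i - 1) / q ≤ w i / N := by
        rw [div_le_iff₀ hq]
        have : w i / N * q = w i * (q / N) := by ring
        rw [this]
        nlinarith [hw0 i]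
      have := Real.add_one_le_exp (w i / N)
      linarith
    calc _ ≤ ∏ i, Real.exp (w i / N) := Finset.prod_le_prod
          (fun i _ => Finset.expect_nonneg fun x _ => by split_ifs <;> positivity)
          (fun i _ => h1 i)
      _ = Real.exp ((∑ i, w i) / N) := by rw [← Real.exp_sum, Finset.sum_div]
      _ ≤ _ := Real.exp_le_exp.2 ((div_le_one hN0).2 hN)
  calc _ ≤ 𝔼 h : Fin n → Fin q, ∑ b, (N / q) ^ k *
          ∏ i, (if h i = b then (q / N) ^ w i else 1) := Finset.expect_le_expect fun h _ => hbound h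
    _ = ∑ b, (N / q) ^ k * 𝔼 h : Fin n → Fin q,
          ∏ i, (if h i = b then (q / N) ^ w i else 1) := by
        rw [Finset.expect_sum_comm]
        simp only [Finset.mul_expect]
    _ ≤ ∑ b : Fin q, (N / q) ^ k * Real.exp 1 := Finset.sum_le_sum fun b _ =>
        mul_le_mul_of_nonneg_left (hprod b) (by positivity)
    _ = _ := by rw [Finset.sum_const, Finset.card_univ, Fintype.card_fin, nsmul_eq_mul]; ring

/-! ### The embedding restricted to a set of coordinates -/

section Sketch

variable {n a v q : ℕ}

/-- The row of the embedding that coordinate `p.2` meets in the `p.1`-th sparse embedding. -/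
def cellOf (h : Fin n → Fin q) (g : Fin a → Fin n → Fin v) (p : Fin a × Fin n) :
    Fin q × Fin a × Fin v :=
  (h p.2, p.1, g p.1 p.2)

/-- The entries of `√a * S x`, for `x` restricted to the coordinates in `J`. -/
def sketchRow (h : Fin n → Fin q) (g : Fin a → Fin n → Fin v) (s : Fin a × Fin n → Bool)
    (J : Finset (Fin n)) (x : Fin n → ℝ) (k : Fin q × Fin a × Fin v) : ℝ :=
  cellSum (cellOf h g) (fun p => x p.2) s (Finset.univ ×ˢ J) k

/-- The bilinear form of `a * ‖S x‖ ^ 2`, for `x` restricted to the coordinates in `J`. -/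
def sketchForm (h : Fin n → Fin q) (g : Fin a → Fin n → Fin v) (s : Fin a × Fin n → Bool)
    (J : Finset (Fin n)) : LinearMap.BilinForm ℝ (EuclideanSpace ℝ (Fin n)) :=
  LinearMap.mk₂ ℝ (fun x y => ∑ k, sketchRow h g s J x.ofLp k * sketchRow h g s J y.ofLp k)
    (fun x x' y => by
      rw [← Finset.sum_add_distrib]
      refine Finset.sum_congr rfl fun k _ => ?_
      rw [← add_mul]
      congr 1
      simp only [sketchRow, cellSum, ← Finset.sum_add_distrib]
      exact Finset.sum_congr rfl fun p _ => by split_ifs <;> simp [mul_add])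
    (fun r x y => by
      simp only [smul_eq_mul, Finset.mul_sum]
      refine Finset.sum_congr rfl fun k _ => ?_
      rw [← mul_assoc]
      congr 1
      simp only [sketchRow, cellSum, Finset.mul_sum]
      exact Finset.sum_congr rfl fun p _ => by split_ifs <;> simp; ring)
    (fun x y y' => by
      rw [← Finset.sum_add_distrib]
      refine Finset.sum_congr rfl fun k _ => ?_
      rw [← mul_add]
      congr 1
      simp only [sketchRow, cellSum, ← Finset.sum_add_distrib]
      exact Finset.sum_congr rfl fun p _ => by split_ifs <;> simp [mul_add])
    (fun r x y => by
      simp only [smul_eq_mul, Finset.mul_sum]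
      refine Finset.sum_congr rfl fun k _ => ?_
      rw [mul_left_comm]
      congr 1
      simp only [sketchRow, cellSum, Finset.mul_sum]
      exact Finset.sum_congr rfl fun p _ => by split_ifs <;> simp; ring)

/-- The squared norm of `x` restricted to the coordinates in `J`. -/
def massOn (J : Finset (Fin n)) (x : Fin n → ℝ) : ℝ := ∑ i ∈ J, x i ^ 2

/-- The bilinear form of `massOn J`. -/
def massForm (J : Finset (Fin n)) : LinearMap.BilinForm ℝ (EuclideanSpace ℝ (Fin n)) :=
  LinearMap.mk₂ ℝ (fun x y => ∑ i ∈ J, x.ofLp i * y.ofLp i)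
    (fun x x' y => by simp [add_mul, Finset.sum_add_distrib])
    (fun r x y => by simp [Finset.mul_sum, mul_assoc])
    (fun x y y' => by simp [mul_add, Finset.sum_add_distrib])
    (fun r x y => by simp [Finset.mul_sum, mul_left_comm])

/-- `a * ‖S x‖ ^ 2`, for `x` restricted to the coordinates in `J`. -/
def sketchSq (h : Fin n → Fin q) (g : Fin a → Fin n → Fin v) (s : Fin a × Fin n → Bool)
    (J : Finset (Fin n)) (x : Fin n → ℝ) : ℝ :=
  ∑ k, sketchRow h g s J x k ^ 2

lemma sketchForm_self (h : Fin n → Fin q) (g : Fin a → Fin n → Fin v) (s : Fin a × Fin n → Bool)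
    (J : Finset (Fin n)) (x : EuclideanSpace ℝ (Fin n)) :
    sketchForm h g s J x x = sketchSq h g s J x.ofLp := by
  simp [sketchForm, sketchSq, sq]

lemma massForm_self (J : Finset (Fin n)) (x : EuclideanSpace ℝ (Fin n)) :
    massForm J x x = massOn J x.ofLp := by
  simp [massForm, massOn, sq]

lemma massOn_nonneg (J : Finset (Fin n)) (x : Fin n → ℝ) : 0 ≤ massOn J x :=
  Finset.sum_nonneg fun _ _ => sq_nonneg _

lemma massOn_le (J : Finset (Fin n)) (x : EuclideanSpace ℝ (Fin n)) :
    massOn J x.ofLp ≤ ‖x‖ ^ 2 := by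
  rw [EuclideanSpace.real_norm_sq_eq]
  exact Finset.sum_le_univ_sum_of_nonneg fun _ => sq_nonneg _

lemma massOn_add_compl (J : Finset (Fin n)) (x : EuclideanSpace ℝ (Fin n)) :
    massOn J x.ofLp + massOn Jᶜ x.ofLp = ‖x‖ ^ 2 := by
  rw [EuclideanSpace.real_norm_sq_eq]
  exact Finset.sum_add_sum_compl _ _

lemma sum_cellMass (h : Fin n → Fin q) (g : Fin a → Fin n → Fin v) (J : Finset (Fin n))
    (x : Fin n → ℝ) :
    ∑ k, cellMass (cellOf h g) (fun p => x p.2) (Finset.univ ×ˢ J) k = a * massOn J x := by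
  simp only [cellMass]
  rw [Finset.sum_comm]
  simp [Finset.sum_product, massOn]

lemma cellMass_le_bucket (h : Fin n → Fin q) (g : Fin a → Fin n → Fin v) (J : Finset (Fin n))
    (x : Fin n → ℝ) (k : Fin q × Fin a × Fin v) :
    cellMass (cellOf h g) (fun p => x p.2) (Finset.univ ×ˢ J) k ≤
      ∑ i ∈ J, if h i = k.1 then x i ^ 2 else 0 := by
  rw [cellMass, Finset.sum_product_right]
  refine Finset.sum_le_sum fun i _ => ?_
  rw [Finset.sum_eq_single k.2.1]
  · simp only [cellOf, Prod.ext_iff]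
    split_ifs with h1 h2
    · rfl
    · exact absurd h1.1 h2
    · positivity
    · rfl
  · intro j _ hj
    rw [if_neg]
    rintro rfl
    exact hj rfl
  · simp

lemma sketchRow_congr (h : Fin n → Fin q) (g : Fin a → Fin n → Fin v)
    {s t : Fin a × Fin n → Bool} {J : Finset (Fin n)} {x y : Fin n → ℝ}
    (hst : ∀ p, p.2 ∈ J → s p = t p) (hxy : ∀ i ∈ J, x i = y i) :
    sketchRow h g s J x = sketchRow h g t J y := by
  ext k
  refine Finset.sum_congr rfl fun p hp => ?_
  have hp' := (Finset.mem_product.1 hp).2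
  simp only [hst p hp', hxy _ hp']

lemma sketchRow_add_compl (h : Fin n → Fin q) (g : Fin a → Fin n → Fin v)
    (s : Fin a × Fin n → Bool) (J : Finset (Fin n)) (x : Fin n → ℝ)
    (k : Fin q × Fin a × Fin v) :
    sketchRow h g s J x k + sketchRow h g s Jᶜ x k = sketchRow h g s Finset.univ x k := by
  simp only [sketchRow, cellSum, Finset.sum_product, ← Finset.sum_add_distrib,
    Finset.sum_add_sum_compl]

/-! ### Heavy coordinates -/

/-- Two distinct coordinates meet in a uniformly random one of `v` rows with probability `1 / v`;
hence the expected off-diagonal mass is small. -/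
lemma expect_pairs_le [NeZero v] (J : Finset (Fin n)) (x : Fin n → ℝ) :
    (𝔼 γ : Fin n → Fin v, ∑ i ∈ J, ∑ i' ∈ J,
      if γ i = γ i' ∧ i ≠ i' then x i ^ 2 * x i' ^ 2 else 0) ≤ massOn J x ^ 2 / v := by
  rw [Finset.expect_sum_comm, sq, massOn, Finset.sum_mul_sum, Finset.sum_div]
  refine Finset.sum_le_sum fun i _ => ?_
  rw [Finset.expect_sum_comm, Finset.sum_div]
  refine Finset.sum_le_sum fun i' _ => ?_
  by_cases hii : i = i'
  · simp only [hii, ne_eq, not_true_eq_false, and_false, if_false, Finset.expect_const_zero]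
    positivity
  · rw [expect_eq_expect_update i]
    simp only [Function.update_self, Function.update_of_ne (Ne.symm hii), hii, ne_eq,
      not_false_eq_true, and_true]
    refine Finset.expect_le Finset.univ_nonempty fun γ _ => ?_
    rw [Fintype.expect_eq_sum_div_card]
    simp

/-- The Kane-Nelson tail bound for one vector: the embeddings `j < a` are independent, and each
contributes a chaos whose variance is `O(1 / v)`. -/
theorem expect_sketch_tail_le [NeZero v] (h : Fin n → Fin q) (J : Finset (Fin n)) (x : Fin n → ℝ)
    (hx : massOn J x ≤ 9 / 4) (t : ℝ) :
    (𝔼 g : Fin a → Fin n → Fin v, 𝔼 s, ind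
      {s | t < |sketchSq h g s J x - a * massOn J x|} s) ≤
      2 * Real.exp (-(t / 25) + a / (30 * v)) := by
  have hv : (0 : ℝ) < v := by exact_mod_cast Nat.pos_of_ne_zero (NeZero.ne v)
  set P : (Fin n → Fin v) → ℝ := fun γ => ∑ i ∈ J, ∑ i' ∈ J,
      if γ i = γ i' ∧ i ≠ i' then x i ^ 2 * x i' ^ 2 else 0 with hP
  have hP0 : ∀ γ, 0 ≤ P γ := fun γ => Finset.sum_nonneg fun i _ => Finset.sum_nonneg fun i' _ => by
    split_ifs <;> positivity
  have hPle : ∀ γ, P γ ≤ massOn J x ^ 2 := by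
    intro γ
    rw [sq, massOn, Finset.sum_mul_sum]
    exact Finset.sum_le_sum fun i _ => Finset.sum_le_sum fun i' _ => by
      split_ifs
      · exact le_rfl
      · positivity
  have hsq : massOn J x ^ 2 ≤ 81 / 16 := by nlinarith [massOn_nonneg J x]
  have hg : ∀ g : Fin a → Fin n → Fin v, (𝔼 s, ind
      {s | t < |sketchSq h g s J x - a * massOn J x|} s) ≤
      2 * Real.exp (-(t / 25)) * ∏ j, Real.exp (2 / 625 * P (g j)) := by
    intro g
    have hpm : ∑ k, pairMass (cellOf h g) (fun p => x p.2) (Finset.univ ×ˢ J) k ≤ ∑ j, P (g j) := by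
      rw [sum_pairMass, Finset.sum_product]
      refine Finset.sum_le_sum fun j _ => Finset.sum_le_sum fun i _ => ?_
      rw [Finset.sum_product_right]
      refine Finset.sum_le_sum fun i' _ => ?_
      rw [Finset.sum_eq_single j]
      · simp only [cellOf, Prod.mk.injEq, true_and, ne_eq]
        split_ifs <;> first | exact le_rfl | positivity | (exfalso; tauto)
      · intro j' _ hj
        rw [if_neg]
        simp [cellOf, hj.symm]
      · simp
    -- `1 / 25` respects the constraint `l * W ≤ 1 / 10` for mass `W = (3 / 2) ^ 2`.
    have key := expect_chaos_tail_le (cellOf h g) (fun p => x p.2) (l := 1 / 25) (W := 9 / 4)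
      (Q := ∑ j, P (g j)) t (Finset.univ ×ˢ J) (by norm_num) (by norm_num)
      (fun k => (cellMass_le_bucket h g J x k).trans (le_trans (Finset.sum_le_sum fun i _ => by
        split_ifs
        · exact le_rfl
        · positivity) hx))
      (fun _ => 1) (fun _ => zero_le_one) (fun _ => le_rfl) (fun _ _ => 0) (fun _ _ _ => rfl)
      (fun _ _ _ => rfl) (fun s _ => by simpa using hpm)
    simp only [one_mul, zero_add, ne_eq, OfNat.ofNat_ne_zero, not_false_eq_true, zero_pow, sub_zero,
      Finset.sum_sub_distrib, sum_cellMass] at key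
    refine key.trans (le_of_eq ?_)
    rw [← Real.exp_sum, mul_assoc 2 (Real.exp _), ← Real.exp_add, ← Finset.mul_sum]
    congr 2
    ring
  refine (Finset.expect_le_expect fun g _ => hg g).trans ?_
  rw [← Finset.mul_expect, expect_prod_pi (fun _ γ => Real.exp (2 / 625 * P γ)), Real.exp_add,
    mul_assoc]
  gcongr
  -- The exponent is bounded, so that its exponential is linear in `P γ` up to a constant.
  have h1 : ∀ γ, Real.exp (2 / 625 * P γ) ≤ 1 + 4 / 625 * P γ := by
    intro γ
    have hb : |2 / 625 * P γ| ≤ 1 := by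
      rw [abs_of_nonneg (mul_nonneg (by norm_num) (hP0 γ))]
      linarith [hPle γ]
    have := (abs_le.1 (Real.abs_exp_sub_one_le hb)).2
    rw [abs_of_nonneg (mul_nonneg (by norm_num) (hP0 γ))] at this
    linarith
  have h2 : (𝔼 γ : Fin n → Fin v, Real.exp (2 / 625 * P γ)) ≤ Real.exp (1 / (30 * v)) := by
    have h3 : (𝔼 γ, P γ) ≤ 81 / 16 / v :=
      (expect_pairs_le J x).trans (by gcongr)
    calc _ ≤ 𝔼 γ : Fin n → Fin v, (1 + 4 / 625 * P γ) := Finset.expect_le_expect fun γ _ => h1 γ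
      _ = 1 + 4 / 625 * 𝔼 γ, P γ := by
          rw [Finset.expect_add_distrib, ← Finset.mul_expect, Fintype.expect_const]
      _ ≤ 1 / (30 * v) + 1 := by
          have : (1 : ℝ) / (30 * v) = 4 / 625 * (81 / 16 / v) + (1 / 30 - 81 / 2500) / v := by
            field_simp; norm_num
          have : 0 ≤ ((1 : ℝ) / 30 - 81 / 2500) / v := by apply div_nonneg <;> norm_num
          linarith
      _ ≤ _ := Real.add_one_le_exp _
  calc _ ≤ ∏ _j : Fin a, Real.exp (1 / (30 * v)) := Finset.prod_le_prod
        (fun _ _ => Finset.expect_nonneg fun _ _ => (Real.exp_nonneg _)) fun _ _ => h2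
    _ = _ := by
      rw [Finset.prod_const, Finset.card_univ, Fintype.card_fin, ← Real.exp_nat_mul]
      congr 1
      ring

/-- `S` preserves the squared norm of all vectors that are supported in `J`, up to `ε / 2`. -/
def GoodOn (ε : ℝ) (h : Fin n → Fin q) (g : Fin a → Fin n → Fin v) (J : Finset (Fin n)) :
    Set (Fin a × Fin n → Bool) :=
  {s | ∀ x : Fin n → ℝ, |sketchSq h g s J x - a * massOn J x| ≤ a * (ε / 2) * massOn J x}

/-- A few coordinates are handled by a net of the coordinate subspace that they span. -/
theorem expect_not_goodOn_le [NeZero v] {ε : ℝ} (h : Fin n → Fin q) (J : Finset (Fin n)) :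
    (𝔼 g : Fin a → Fin n → Fin v, 𝔼 s, ind (GoodOn ε h g J)ᶜ s) ≤
      25 ^ J.card * (2 * Real.exp (-(a * (ε / 6) / 25) + a / (30 * v))) := by
  classical
  let V : Submodule ℝ (EuclideanSpace ℝ (Fin n)) := Submodule.span ℝ
    (J.image fun i => EuclideanSpace.single i (1 : ℝ) : Finset (EuclideanSpace ℝ (Fin n)))
  have hV : Module.finrank ℝ V ≤ J.card :=
    (finrank_span_finset_le_card _).trans Finset.card_image_le
  obtain ⟨N, hN1, hN2, hN3⟩ := exists_quadratic_net V
  have hbad : ∀ (g : Fin a → Fin n → Fin v) s, ind (GoodOn ε h g J)ᶜ s ≤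
      ∑ x ∈ N, ind
        {s | a * (ε / 6) < |sketchSq h g s J x.ofLp - a * massOn J x.ofLp|} s := by
    intro g s
    refine ind_le_sum fun hs => ?_
    by_contra! hlt
    refine hs fun x => ?_
    have hB := hN3 (sketchForm h g s J - (a : ℝ) • massForm J) (a * (ε / 6)) (fun y hy => by
      simpa [sketchForm_self, massForm_self] using hlt y hy)
      (WithLp.toLp 2 fun i => if i ∈ J then x i else 0) ?_
    · have e1 : massOn J (fun i => if i ∈ J then x i else 0) = massOn J x :=
        Finset.sum_congr rfl fun i hi => by simp only [if_pos hi]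
      have e2 : sketchSq h g s J (fun i => if i ∈ J then x i else 0) = sketchSq h g s J x := by
        rw [sketchSq, sketchRow_congr h g (fun _ _ => rfl) (fun i hi => if_pos hi), sketchSq]
      have e3 : ‖(WithLp.toLp 2 fun i => if i ∈ J then x i else 0 : EuclideanSpace ℝ (Fin n))‖ ^ 2 =
          massOn J x := by
        rw [EuclideanSpace.real_norm_sq_eq]
        simp [massOn]
      simp only [LinearMap.sub_apply, LinearMap.smul_apply, sketchForm_self, massForm_self,
        smul_eq_mul, e1, e2, e3] at hB
      exact hB.trans (le_of_eq (by ring))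
    · have : (WithLp.toLp 2 fun i => if i ∈ J then x i else 0 : EuclideanSpace ℝ (Fin n)) =
          ∑ i ∈ J, x i • EuclideanSpace.single i (1 : ℝ) := by
        ext i
        simp [Pi.single_apply]
      rw [this]
      exact Submodule.sum_mem _ fun i hi => Submodule.smul_mem _ _
        (Submodule.subset_span (Finset.mem_coe.2 (Finset.mem_image_of_mem _ hi)))
  calc _ ≤ 𝔼 g : Fin a → Fin n → Fin v, 𝔼 s, ∑ x ∈ N, ind
        {s | a * (ε / 6) < |sketchSq h g s J x.ofLp - a * massOn J x.ofLp|} s :=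
        Finset.expect_le_expect fun g _ => Finset.expect_le_expect fun s _ => hbad g s
    _ = ∑ x ∈ N, 𝔼 g : Fin a → Fin n → Fin v, 𝔼 s, ind
        {s | a * (ε / 6) < |sketchSq h g s J x.ofLp - a * massOn J x.ofLp|} s := by
        simp only [Finset.expect_sum_comm]
    _ ≤ ∑ x ∈ N, 2 * Real.exp (-(a * (ε / 6) / 25) + a / (30 * v)) :=
        Finset.sum_le_sum fun x hx => expect_sketch_tail_le h J x.ofLp
          ((massOn_le J x).trans (by nlinarith [(hN1 x hx).2, norm_nonneg x])) _
    _ ≤ _ := by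
        rw [Finset.sum_const, nsmul_eq_mul]
        gcongr
        calc (N.card : ℝ) ≤ ((25 ^ Module.finrank ℝ V : ℕ) : ℝ) := by exact_mod_cast hN2
          _ ≤ 25 ^ J.card := by
            push_cast
            exact pow_le_pow_right₀ (by norm_num) hV

/-- Different buckets use different rows. -/
lemma sketchSq_eq_sum_buckets (h : Fin n → Fin q) (g : Fin a → Fin n → Fin v)
    (s : Fin a × Fin n → Bool) (J : Finset (Fin n)) (x : Fin n → ℝ) :
    sketchSq h g s J x = ∑ b, sketchSq h g s (J.filter (h · = b)) x := by
  have hrow : ∀ b k, sketchRow h g s (J.filter (h · = b)) x k =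
      if k.1 = b then sketchRow h g s J x k else 0 := by
    intro b k
    simp only [sketchRow, cellSum, Finset.sum_product, Finset.sum_filter]
    split_ifs with hk
    · refine Finset.sum_congr rfl fun j _ => Finset.sum_congr rfl fun i _ => ?_
      by_cases h1 : h i = b
      · simp [h1]
      · rw [if_neg h1, if_neg]
        rintro rfl
        exact h1 hk
    · refine Finset.sum_eq_zero fun j _ => Finset.sum_eq_zero fun i _ => ?_
      split_ifs with h1 h2
      · subst h2; exact absurd h1 hk
      · rfl
      · rfl
  simp only [sketchSq, hrow]
  rw [Finset.sum_comm]
  refine Finset.sum_congr rfl fun k _ => ?_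
  simp

lemma goodOn_of_buckets {ε : ℝ} {h : Fin n → Fin q} {g : Fin a → Fin n → Fin v}
    {J : Finset (Fin n)} {s : Fin a × Fin n → Bool}
    (H : ∀ b ∈ J.image h, s ∈ GoodOn ε h g (J.filter (h · = b))) : s ∈ GoodOn ε h g J := by
  intro x
  have hm : massOn J x = ∑ b, massOn (J.filter (h · = b)) x :=
    (Finset.sum_fiberwise J h _).symm
  rw [sketchSq_eq_sum_buckets, hm, Finset.mul_sum, Finset.mul_sum, ← Finset.sum_sub_distrib]
  refine (Finset.abs_sum_le_sum_abs _ _).trans (Finset.sum_le_sum fun b _ => ?_)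
  by_cases hb : b ∈ J.image h
  · exact H b hb x
  · have : J.filter (h · = b) = ∅ := Finset.filter_eq_empty_iff.2 fun i hi hib =>
      hb (Finset.mem_image.2 ⟨i, hi, hib⟩)
    rw [this]
    simp [sketchSq, sketchRow, cellSum, massOn]

/-- If no bucket holds more than `m` heavy coordinates, then all vectors supported on the heavy
coordinates are preserved, with high probability. -/
theorem expect_not_goodOn_heavy_le [NeZero v] {ε : ℝ} {m : ℕ} (h : Fin n → Fin q)
    (J : Finset (Fin n)) (hm : ∀ b, (J.filter (h · = b)).card ≤ m) :
    (𝔼 g : Fin a → Fin n → Fin v, 𝔼 s, ind (GoodOn ε h g J)ᶜ s) ≤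
      J.card * (25 ^ m * (2 * Real.exp (-(a * (ε / 6) / 25) + a / (30 * v)))) := by
  have hbad : ∀ (g : Fin a → Fin n → Fin v) s, ind (GoodOn ε h g J)ᶜ s ≤
      ∑ b ∈ J.image h, ind (GoodOn ε h g (J.filter (h · = b)))ᶜ s := by
    intro g s
    refine ind_le_sum fun hs => ?_
    by_contra! hlt
    exact hs (goodOn_of_buckets fun b hb => not_not.1 (hlt b hb))
  calc _ ≤ 𝔼 g : Fin a → Fin n → Fin v, 𝔼 s, ∑ b ∈ J.image h,
        ind (GoodOn ε h g (J.filter (h · = b)))ᶜ s :=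
        Finset.expect_le_expect fun g _ => Finset.expect_le_expect fun s _ => hbad g s
    _ = ∑ b ∈ J.image h, 𝔼 g : Fin a → Fin n → Fin v, 𝔼 s,
        ind (GoodOn ε h g (J.filter (h · = b)))ᶜ s := by
        simp only [Finset.expect_sum_comm]
    _ ≤ ∑ b ∈ J.image h, 25 ^ m * (2 * Real.exp (-(a * (ε / 6) / 25) + a / (30 * v))) :=
        Finset.sum_le_sum fun b _ => (expect_not_goodOn_le h _).trans (by
          gcongr
          exacts [by norm_num, hm b])
    _ ≤ _ := by
        rw [Finset.sum_const, nsmul_eq_mul]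
        gcongr
        exact Finset.card_image_le

/-! ### Light coordinates -/

/-- The part of `‖S y‖ ^ 2` that involves light coordinates is close to their squared norm, for
all `y` in `V`. -/
def LightGood (ε : ℝ) (h : Fin n → Fin q) (g : Fin a → Fin n → Fin v) (J : Finset (Fin n))
    (V : Submodule ℝ (EuclideanSpace ℝ (Fin n))) : Set (Fin a × Fin n → Bool) :=
  {s | ∀ y ∈ V, |sketchSq h g s Finset.univ y.ofLp - sketchSq h g s J y.ofLp -
    a * massOn Jᶜ y.ofLp| ≤ a * (ε / 2) * ‖y‖ ^ 2}

/-- Given the signs of the heavy coordinates `J`, the light part of one vector is a chaos all of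
whose cells have mass at most `W`. -/
theorem expect_light_tail_le {ε W : ℝ} (hε1 : ε ≤ 1) (h : Fin n → Fin q)
    (g : Fin a → Fin n → Fin v) (J : Finset (Fin n)) (x : Fin n → ℝ) (hW : 0 < W)
    (hxW : ∀ b, (∑ i ∈ Jᶜ, if h i = b then x i ^ 2 else 0) ≤ W)
    (hxJ : massOn J x ≤ 9 / 4) (hxJc : massOn Jᶜ x ≤ 9 / 4) {τ : ℝ} (hτ : 0 ≤ τ) (hτ1 : τ ≤ 1) :
    (𝔼 s, ind (GoodOn ε h g J) s * ind {s | a * τ <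
      |sketchSq h g s Finset.univ x - sketchSq h g s J x - a * massOn Jᶜ x|} s) ≤
      2 * Real.exp (-(a * τ ^ 2 / (90 * W))) := by
  have hcm : ∀ k, cellMass (cellOf h g) (fun p => x p.2) (Finset.univ ×ˢ Jᶜ) k ≤ W :=
    fun k => (cellMass_le_bucket h g Jᶜ x k).trans (hxW k.1)
  have hnotin : ∀ p : Fin a × Fin n, p.2 ∈ J → p ∉ (Finset.univ : Finset (Fin a)) ×ˢ Jᶜ :=
    fun p hp hp' => (Finset.mem_compl.1 (Finset.mem_product.1 hp').2) hp
  -- This `l` minimizes the exponent `-l * (a * τ) + 2 * l ^ 2 * Q`.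
  have key := expect_chaos_tail_le (cellOf h g) (fun p => x p.2) (l := τ / (45 * W)) (W := W)
    (Q := W * (a * (45 / 4))) (a * τ) (Finset.univ ×ˢ Jᶜ) (by positivity)
    (by rw [show τ / (45 * W) * W = τ / 45 by field_simp]; linarith) hcm
    (ind (GoodOn ε h g J)) (ind_nonneg _) (ind_le_one _)
    (fun s k => sketchRow h g s J x k)
    (fun s t hst => by
      have : s ∈ GoodOn ε h g J ↔ t ∈ GoodOn ε h g J := by
        simp only [GoodOn, Set.mem_ofPred_eq, sketchSq]
        refine forall_congr' fun x => ?_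
        rw [sketchRow_congr h g (fun p hp => hst p (hnotin p hp)) fun _ _ => rfl]
      by_cases hs : s ∈ GoodOn ε h g J
      · rw [ind_of_mem hs, ind_of_mem (this.1 hs)]
      · rw [ind_of_notMem hs, ind_of_notMem fun ht => hs (this.2 ht)])
    (fun s t hst => sketchRow_congr h g (fun p hp => hst p (hnotin p hp)) fun _ _ => rfl)
    (fun s hs => by
      have hgood : s ∈ GoodOn ε h g J := by
        by_contra hs'
        exact hs (ind_of_notMem hs')
      have h1 : sketchSq h g s J x ≤ a * (9 / 2) := by
        have h2 := (abs_le.1 (hgood x)).2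
        have h3 : (a : ℝ) * (ε / 2) * massOn J x ≤ a * massOn J x := by
          have := mul_nonneg (Nat.cast_nonneg (α := ℝ) a) (massOn_nonneg J x)
          nlinarith
        have h4 : (a : ℝ) * massOn J x ≤ a * (9 / 4) := by gcongr
        linarith
      calc ∑ k, (pairMass (cellOf h g) (fun p => x p.2) (Finset.univ ×ˢ Jᶜ) k +
            2 * sketchRow h g s J x k ^ 2 *
              cellMass (cellOf h g) (fun p => x p.2) (Finset.univ ×ˢ Jᶜ) k)
          ≤ ∑ k, (W * cellMass (cellOf h g) (fun p => x p.2) (Finset.univ ×ˢ Jᶜ) k +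
            W * (2 * sketchRow h g s J x k ^ 2)) := Finset.sum_le_sum fun k _ => by
            have hM0 := cellMass_nonneg (cellOf h g) (fun p => x p.2) (Finset.univ ×ˢ Jᶜ) k
            have hM := hcm k
            have hp : pairMass (cellOf h g) (fun p => x p.2) (Finset.univ ×ˢ Jᶜ) k ≤
                cellMass (cellOf h g) (fun p => x p.2) (Finset.univ ×ˢ Jᶜ) k ^ 2 :=
              sub_le_self _ (Finset.sum_nonneg fun i _ => by split_ifs <;> positivity)
            refine add_le_add (hp.trans (by rw [sq]; gcongr)) ?_
            rw [mul_comm W]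
            gcongr
        _ = W * (a * massOn Jᶜ x + 2 * sketchSq h g s J x) := by
            rw [Finset.sum_add_distrib, ← Finset.mul_sum, ← Finset.mul_sum, ← Finset.mul_sum,
              sum_cellMass, sketchSq]
            ring
        _ ≤ W * (a * (45 / 4)) := by
            have : (a : ℝ) * massOn Jᶜ x ≤ a * (9 / 4) := by gcongr
            gcongr
            linarith)
  refine le_trans (le_of_eq (Finset.expect_congr rfl fun s _ => ?_)) (key.trans (le_of_eq ?_))
  · have hD : ∀ s, ∑ k, ((sketchRow h g s J x k +
        cellSum (cellOf h g) (fun p => x p.2) s (Finset.univ ×ˢ Jᶜ) k) ^ 2 -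
        sketchRow h g s J x k ^ 2 -
        cellMass (cellOf h g) (fun p => x p.2) (Finset.univ ×ˢ Jᶜ) k) =
        sketchSq h g s Finset.univ x - sketchSq h g s J x - a * massOn Jᶜ x := by
      intro s
      rw [Finset.sum_sub_distrib, Finset.sum_sub_distrib, sum_cellMass, sketchSq, sketchSq]
      refine congrArg₂ _ (congrArg₂ _ (Finset.sum_congr rfl fun k _ => ?_) rfl) rfl
      rw [← sketchRow_add_compl h g s J x]; rfl
    simp only [hD]
  · congr 2
    field_simp
    ring

/-- A net of `V` handles the light parts of all vectors of `V`. -/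
theorem expect_not_lightGood_le {ε W : ℝ} (hε : 0 < ε) (hε1 : ε ≤ 1) (h : Fin n → Fin q)
    (g : Fin a → Fin n → Fin v) (J : Finset (Fin n))
    (V : Submodule ℝ (EuclideanSpace ℝ (Fin n))) (hW : 0 < W) (u : Fin n → ℝ)
    (hu : ∀ y ∈ V, ∀ i, y i ^ 2 ≤ u i * ‖y‖ ^ 2) (hu0 : ∀ i, 0 ≤ u i)
    (huW : ∀ b, (∑ i ∈ Jᶜ, if h i = b then u i else 0) ≤ W) :
    (𝔼 s, ind (GoodOn ε h g J) s * ind (LightGood ε h g J V)ᶜ s) ≤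
      25 ^ Module.finrank ℝ V * (2 * Real.exp (-(a * (ε / 6) ^ 2 / (90 * (9 / 4 * W))))) := by
  obtain ⟨N, hN1, hN2, hN3⟩ := exists_quadratic_net V
  have hbad : ∀ s, ind (LightGood ε h g J V)ᶜ s ≤
      ∑ x ∈ N, ind {s | a * (ε / 6) < |sketchSq h g s Finset.univ x.ofLp -
        sketchSq h g s J x.ofLp - a * massOn Jᶜ x.ofLp|} s := by
    intro s
    refine ind_le_sum fun hs => ?_
    by_contra! hlt
    refine hs fun y hy => ?_
    have hB := hN3 (sketchForm h g s Finset.univ - sketchForm h g s J - (a : ℝ) • massForm Jᶜ)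
      (a * (ε / 6)) (fun y hy => by
        simpa [sketchForm_self, massForm_self] using hlt y hy) y hy
    simp only [LinearMap.sub_apply, LinearMap.smul_apply, sketchForm_self, massForm_self,
      smul_eq_mul] at hB
    exact hB.trans (le_of_eq (by ring))
  calc _ ≤ 𝔼 s, ∑ x ∈ N, ind (GoodOn ε h g J) s * ind {s | a * (ε / 6) <
        |sketchSq h g s Finset.univ x.ofLp -
          sketchSq h g s J x.ofLp - a * massOn Jᶜ x.ofLp|} s :=
        Finset.expect_le_expect fun s _ => by
          rw [← Finset.mul_sum]
          exact mul_le_mul_of_nonneg_left (hbad s) (ind_nonneg _ _)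
    _ ≤ ∑ x ∈ N, 2 * Real.exp (-(a * (ε / 6) ^ 2 / (90 * (9 / 4 * W)))) := by
        rw [Finset.expect_sum_comm]
        refine Finset.sum_le_sum fun x hx => ?_
        have hx2 : ‖x‖ ^ 2 ≤ 9 / 4 := by nlinarith [(hN1 x hx).2, norm_nonneg x]
        refine expect_light_tail_le hε1 h g J x.ofLp (by positivity) (fun b => ?_)
          ((massOn_le J x).trans hx2) ((massOn_le Jᶜ x).trans hx2) (by positivity) (by linarith)
        refine le_trans ?_ (mul_le_mul_of_nonneg_left (huW b) (by norm_num : (0 : ℝ) ≤ 9 / 4))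
        rw [Finset.mul_sum]
        refine Finset.sum_le_sum fun i _ => ?_
        split_ifs
        · refine (hu x (hN1 x hx).1 i).trans ?_
          rw [mul_comm]
          exact mul_le_mul_of_nonneg_right hx2 (hu0 i)
        · simp
    _ ≤ _ := by
        rw [Finset.sum_const, nsmul_eq_mul]
        gcongr
        exact_mod_cast hN2

end Sketch

/-! ### The failure probability -/

section Failure

variable {n d a v q : ℕ}

/-- The uniform probability of an event as an average. -/
lemma uniformOn_univ_real_eq_expect {Ω : Type*} [Fintype Ω] [MeasurableSpace Ω]
    [MeasurableSingletonClass Ω] (S : Set Ω) :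
    (uniformOn (Set.univ : Set Ω)).real S = 𝔼 ω, ind S ω := by
  classical
  rw [Measure.real, uniformOn_univ, Measure.count_apply_finite S S.toFinite,
    Fintype.expect_eq_sum_div_card, ENNReal.toReal_div, ENNReal.toReal_natCast,
    ENNReal.toReal_natCast]
  congr 1
  simp [ind, Set.indicator_apply]

lemma sketchSq_eq_norm_sq (ha : 0 < a) (ω : EmbeddingSeed n a v q) (x : Fin n → ℝ) :
    sketchSq ω.1 ω.2.1 (fun p => ω.2.2 p.1 p.2) Finset.univ x =
      a * ‖WithLp.toLp 2 ((generalizedEmbedding ω).mulVec x)‖ ^ 2 := by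
  have ha' : (0 : ℝ) < a := by exact_mod_cast ha
  rw [EuclideanSpace.real_norm_sq_eq, sketchSq, Finset.mul_sum]
  refine Finset.sum_congr rfl fun k _ => ?_
  obtain ⟨b, j, m⟩ := k
  have h : (generalizedEmbedding ω).mulVec x (b, j, m) =
      1 / √(a : ℝ) * sketchRow ω.1 ω.2.1 (fun p => ω.2.2 p.1 p.2) Finset.univ x (b, j, m) := by
    simp only [Matrix.mulVec, dotProduct, generalizedEmbedding_apply, sketchRow, cellSum,
      Finset.mul_sum, Finset.sum_product_right]
    refine Finset.sum_congr rfl fun i _ => ?_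
    rw [Finset.sum_eq_single j]
    · simp only [cellOf, Prod.mk.injEq, true_and]
      split_ifs <;> ring
    · intro j' _ hj
      simp [cellOf, hj]
    · simp
  simp only [h]
  rw [mul_pow, div_pow, Real.sq_sqrt ha'.le]
  field_simp

/-- The column space of `A`, as a subspace of Euclidean space. -/
def columnSpace (A : Matrix (Fin n) (Fin d) ℝ) : Submodule ℝ (EuclideanSpace ℝ (Fin n)) :=
  (LinearMap.range A.mulVecLin).map (WithLp.linearEquiv 2 ℝ (Fin n → ℝ)).symm.toLinearMap

lemma finrank_columnSpace (A : Matrix (Fin n) (Fin d) ℝ) :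
    Module.finrank ℝ (columnSpace A) = A.rank :=
  LinearEquiv.finrank_map_eq _ _

/-- The errors on the heavy part and on the light part add up to `ε * ‖y‖ ^ 2`, and squared norms
within a factor `1 ± ε` give norms within a factor `1 ± ε`. -/
lemma isSubspaceEmbedding_of_good {ε : ℝ} (hε : 0 < ε) (hε1 : ε < 1) (ha : 0 < a)
    (A : Matrix (Fin n) (Fin d) ℝ) (ω : EmbeddingSeed n a v q) (J : Finset (Fin n))
    (h1 : (fun p => ω.2.2 p.1 p.2) ∈ GoodOn ε ω.1 ω.2.1 J)
    (h2 : (fun p => ω.2.2 p.1 p.2) ∈ LightGood ε ω.1 ω.2.1 J (columnSpace A)) :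
    IsSubspaceEmbedding (generalizedEmbedding ω) A ε := by
  intro y hy
  have ha' : (0 : ℝ) < a := by exact_mod_cast ha
  have e1 := abs_le.1 (h1 y)
  have e2 := abs_le.1 (h2 (WithLp.toLp 2 y) (Submodule.mem_map_of_mem hy))
  have e3 := massOn_add_compl J (WithLp.toLp 2 y)
  have e4 := massOn_le J (WithLp.toLp 2 y)
  simp only at e2 e3 e4
  rw [sketchSq_eq_norm_sq ha] at e2
  set Y := ‖WithLp.toLp 2 y‖
  set Z := ‖WithLp.toLp 2 ((generalizedEmbedding ω).mulVec y)‖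
  have hY : 0 ≤ Y := norm_nonneg _
  have hZ : 0 ≤ Z := norm_nonneg _
  have e5 : (a : ℝ) * (ε / 2) * massOn J y ≤ a * (ε / 2) * Y ^ 2 := by gcongr
  have e6 : (a : ℝ) * massOn Jᶜ y = a * Y ^ 2 - a * massOn J y := by rw [← e3]; ring
  have hup : Z ^ 2 ≤ (1 + ε) * Y ^ 2 := by
    refine le_of_mul_le_mul_left ?_ ha'
    linarith [e1.2, e2.2]
  have hlo : (1 - ε) * Y ^ 2 ≤ Z ^ 2 := by
    refine le_of_mul_le_mul_left ?_ ha'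
    linarith [e1.1, e2.1]
  constructor
  · refine abs_le_of_sq_le_sq' ?_ hZ |>.2
    nlinarith [mul_nonneg (mul_nonneg hε.le (by linarith : 0 ≤ 1 - ε)) (sq_nonneg Y)]
  · refine abs_le_of_sq_le_sq' ?_ (by positivity) |>.2
    nlinarith [mul_nonneg hε.le (sq_nonneg Y), mul_nonneg (sq_nonneg ε) (sq_nonneg Y)]

/-- The three ways to fail: an overfull bucket, a bad block on the heavy coordinates of a bucket,
or a large contribution of the light coordinates. Coordinates are heavy if their leverage score
is at least `T`. -/
theorem expect_not_embedding_le [NeZero v] {ε T : ℝ} (hε : 0 < ε) (hε1 : ε < 1) (ha : 0 < a)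
    (A : Matrix (Fin n) (Fin d) ℝ) (hr : 0 < A.rank) (hT : 0 < T) (m : ℕ) (hm : 0 < m)
    (hq : A.rank / T ≤ q) :
    (𝔼 ω : EmbeddingSeed n a v q,
      ind {ω | IsSubspaceEmbedding (generalizedEmbedding ω) A ε}ᶜ ω) ≤
      q * (Real.exp 1 * (A.rank / T / q) ^ m) +
      (A.rank / T * (25 ^ m * (2 * Real.exp (-(a * (ε / 6) / 25) + a / (30 * v)))) +
      25 ^ A.rank * (2 * Real.exp (-(a * (ε / 6) ^ 2 / (90 * (9 / 4 * (m * T))))))) := by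
  have hr' : (0 : ℝ) < A.rank := by exact_mod_cast hr
  have hm' : (0 : ℝ) < m := by exact_mod_cast hm
  obtain ⟨u, hu0, husum, hu⟩ := exists_leverage (columnSpace A)
  rw [finrank_columnSpace] at husum
  have hq0 : (0 : ℝ) < q := (div_pos hr' hT).trans_le hq
  have : Nonempty (Fin q) := ⟨⟨0, by exact_mod_cast hq0⟩⟩
  have : Nonempty (Fin v) := ⟨0⟩
  set J : Finset (Fin n) := Finset.univ.filter fun i => T ≤ u i with hJ
  set w : Fin n → ℝ := fun i => min (u i / T) 1 with hw
  have hw0 : ∀ i, 0 ≤ w i := fun i => le_min (div_nonneg (hu0 i) hT.le) zero_le_one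
  have hJcard : (J.card : ℝ) ≤ A.rank / T := by
    rw [le_div_iff₀ hT, ← nsmul_eq_mul, ← Finset.sum_const, ← husum]
    exact (Finset.sum_le_sum fun i hi => (Finset.mem_filter.1 hi).2).trans
      (Finset.sum_le_univ_sum_of_nonneg hu0)
  set E : Set (Fin n → Fin q) := {h | ∃ b, (m : ℝ) < ∑ i, if h i = b then w i else 0} with hE
  have hload : (𝔼 h, ind E h) ≤ q * (Real.exp 1 * (A.rank / T / q) ^ m) := by
    refine expect_bucket_load_le w hw0 (fun i => min_le_right _ _) (div_pos hr' hT) ?_ hq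
    rw [← husum, Finset.sum_div]
    exact Finset.sum_le_sum fun i _ => min_le_left _ _
  set p₂ := A.rank / T * (25 ^ m * (2 * Real.exp (-(a * (ε / 6) / 25) + a / (30 * v)))) with hp₂
  set p₃ := 25 ^ A.rank * (2 * Real.exp (-(a * (ε / 6) ^ 2 / (90 * (9 / 4 * (m * T)))))) with hp₃
  have hfix : ∀ h : Fin n → Fin q, (𝔼 g : Fin a → Fin n → Fin v, 𝔼 s : Fin a → Fin n → Bool,
      ind {ω | IsSubspaceEmbedding (generalizedEmbedding ω) A ε}ᶜ (h, g, s)) ≤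
      ind E h + (p₂ + p₃) := by
    intro h
    by_cases hh : h ∈ E
    · rw [ind_of_mem hh]
      have : 0 ≤ p₂ + p₃ := by positivity
      refine (Finset.expect_le Finset.univ_nonempty fun g _ =>
        Finset.expect_le Finset.univ_nonempty fun s _ => ind_le_one _ _).trans ?_
      linarith
    · rw [ind_of_notMem hh, zero_add]
      have hbucket : ∀ b, ∑ i, (if h i = b then w i else 0) ≤ m := fun b => by
        by_contra! hlt
        exact hh ⟨b, hlt⟩
      have hheavy : ∀ b, (J.filter (h · = b)).card ≤ m := fun b => by
        have h1 : ((J.filter (h · = b)).card : ℝ) ≤ ∑ i, (if h i = b then w i else 0) := by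
          rw [Finset.card_filter, Nat.cast_sum]
          refine (Finset.sum_le_sum fun i hi => ?_).trans
            (Finset.sum_le_univ_sum_of_nonneg fun i => by
              split_ifs
              exacts [hw0 i, le_rfl])
          have hwi : w i = 1 := min_eq_right ((one_le_div hT).2 (Finset.mem_filter.1 hi).2)
          rw [hwi]
          split_ifs <;> simp
        exact_mod_cast h1.trans (hbucket b)
      have hlight : ∀ b, (∑ i ∈ Jᶜ, if h i = b then u i else 0) ≤ m * T := fun b => by
        refine le_trans ?_ (mul_le_mul_of_nonneg_right (hbucket b) hT.le)
        rw [Finset.sum_mul]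
        refine (Finset.sum_le_sum fun i hi => ?_).trans
            (Finset.sum_le_univ_sum_of_nonneg fun i => mul_nonneg (by
              split_ifs
              exacts [hw0 i, le_rfl]) hT.le)
        have hi' : u i < T := by
          simpa [hJ] using hi
        have hwi : w i = u i / T := min_eq_left ((div_le_one hT).2 hi'.le)
        rw [hwi]
        split_ifs
        · exact (div_mul_cancel₀ _ hT.ne').ge
        · simp
      have hg : ∀ g : Fin a → Fin n → Fin v, (𝔼 s : Fin a → Fin n → Bool,
          ind {ω | IsSubspaceEmbedding (generalizedEmbedding ω) A ε}ᶜ (h, g, s)) ≤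
          (𝔼 s, ind (GoodOn ε h g J)ᶜ s) + p₃ := by
        intro g
        refine le_trans ?_ (add_le_add_right
          (expect_not_lightGood_le hε hε1.le h g J (columnSpace A) (mul_pos hm' hT) u hu hu0
            hlight) _ |>.trans_eq (by rw [finrank_columnSpace]))
        rw [← Finset.expect_add_distrib, ← Fintype.expect_equiv (Equiv.curry _ _ _).symm _ _
          fun s => rfl]
        refine Finset.expect_le_expect fun s _ => ind_le ?_ fun hs => ?_
        · exact add_nonneg (ind_nonneg _ _) (mul_nonneg (ind_nonneg _ _) (ind_nonneg _ _))
        · by_cases h1 : (Equiv.curry _ _ _).symm s ∈ GoodOn ε h g J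
          · by_cases h2 : (Equiv.curry _ _ _).symm s ∈ LightGood ε h g J (columnSpace A)
            · exact absurd (isSubspaceEmbedding_of_good hε hε1 ha A (h, g, s) J h1 h2) hs
            · rw [ind_of_mem h1, ind_of_mem (Set.mem_compl h2)]
              linarith [ind_nonneg (GoodOn ε h g J)ᶜ ((Equiv.curry _ _ _).symm s)]
          · rw [ind_of_mem (Set.mem_compl h1)]
            exact le_add_of_nonneg_right (mul_nonneg (ind_nonneg _ _) (ind_nonneg _ _))
      refine (Finset.expect_le_expect fun g _ => hg g).trans ?_
      rw [Finset.expect_add_distrib, Fintype.expect_const]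
      refine add_le_add_left ((expect_not_goodOn_heavy_le h J hheavy).trans ?_) _
      exact mul_le_mul_of_nonneg_right hJcard (by positivity)
  rw [← Finset.univ_product_univ, Finset.expect_product, ← Finset.univ_product_univ]
  simp only [Finset.expect_product]
  refine (Finset.expect_le_expect fun h _ => hfix h).trans ?_
  rw [Finset.expect_add_distrib, Fintype.expect_const]
  exact add_le_add_left hload _

end Failure

/-! ### The choice of the parameters -/

lemma log_two_le_log {R : ℝ} (hR : 2 ≤ R) : 1 / 2 ≤ Real.log R := by
  have := Real.log_le_log two_pos hR
  have := Real.log_two_gt_d9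
  linarith

lemma pow_twentyFive_le_exp (m : ℕ) : (25 : ℝ) ^ m ≤ Real.exp (4 * m) := by
  have h : (25 : ℝ) ≤ Real.exp 4 := by
    rw [show (4 : ℝ) = (4 : ℕ) * 1 by norm_num, Real.exp_nat_mul]
    have := Real.exp_one_gt_d9
    calc (25 : ℝ) ≤ 2.7 ^ 4 := by norm_num
      _ ≤ _ := by gcongr; linarith
  calc (25 : ℝ) ^ m ≤ Real.exp 4 ^ m := by gcongr
    _ = _ := by rw [← Real.exp_nat_mul, mul_comm]

/-- The load bound: `q (N/q) ^ m ≤ N * e ^ (1 - m)`, and `m ≥ 10 log R` beats the at most `2 R ^ 3`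
heavy coordinates. -/
lemma load_failure_le {R N Q δ : ℝ} {m : ℕ} (hR : 2 ≤ R) (hδ : 1 ≤ δ * R) (hN0 : 0 < N)
    (hN : N ≤ 2 * R ^ 3) (hQ : 3 * N ≤ Q) (hm : 10 * Real.log R ≤ m) :
    Q * (Real.exp 1 * (N / Q) ^ m) ≤ δ / 4 := by
  have hR0 : 0 < R := by linarith
  have hQ0 : 0 < Q := by linarith
  have hl := log_two_le_log hR
  have hm0 : m ≠ 0 := by
    rintro rfl
    simp at hm
    linarith
  obtain ⟨k, rfl⟩ := Nat.exists_eq_succ_of_ne_zero hm0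
  have he : N / Q ≤ Real.exp (-1) := by
    rw [Real.exp_neg, div_le_iff₀ hQ0, inv_mul_eq_div, le_div_iff₀ (Real.exp_pos _)]
    have := Real.exp_one_lt_d9
    nlinarith
  have hk : (N / Q) ^ k ≤ Real.exp (1 - 10 * Real.log R) := by
    calc (N / Q) ^ k ≤ Real.exp (-1) ^ k := by gcongr
      _ = Real.exp (-k) := by rw [← Real.exp_nat_mul]; congr 1; ring
      _ ≤ _ := Real.exp_le_exp.2 (by push_cast at hm; linarith)
  have hexp : Real.exp (1 - 10 * Real.log R) = Real.exp 1 * (R ^ 10)⁻¹ := by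
    rw [sub_eq_add_neg, Real.exp_add, Real.exp_neg, show 10 * Real.log R = (10 : ℕ) * Real.log R by
      norm_num, Real.exp_nat_mul, Real.exp_log hR0]
  have he2 : Real.exp 1 * Real.exp 1 ≤ 8 := by
    have := Real.exp_one_lt_d9
    nlinarith [Real.exp_pos 1]
  calc Q * (Real.exp 1 * (N / Q) ^ (k + 1)) = N * Real.exp 1 * (N / Q) ^ k := by
        rw [pow_succ]; field_simp
    _ ≤ 2 * R ^ 3 * Real.exp 1 * (Real.exp 1 * (R ^ 10)⁻¹) := by
        rw [← hexp]; gcongr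
    _ = 2 * R ^ 3 * (R ^ 10)⁻¹ * (Real.exp 1 * Real.exp 1) := by ring
    _ ≤ 2 * R ^ 3 * (R ^ 10)⁻¹ * 8 := by gcongr
    _ = 16 / R ^ 6 / R := by field_simp; norm_num
    _ ≤ 1 / 4 / R := by
        refine div_le_div_of_nonneg_right ?_ hR0.le
        rw [div_le_iff₀ (by positivity)]
        have : (2 : ℝ) ^ 6 ≤ R ^ 6 := by gcongr
        linarith
    _ ≤ δ / 4 := by
        rw [div_le_iff₀ hR0]; linarith

/-- The bound for the heavy coordinates: the net of `25 ^ m ≤ R ^ 48` points and the at most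
`2 R ^ 3` heavy coordinates are outweighed by `exp (-a ε / 300)`, as `a ε ≥ 10 ^ 6 log R`. The term
`a / (30 v)` is at most half of the other one because `v ≥ 10 / ε`. -/
lemma heavy_failure_le {R N δ ε a v : ℝ} {m : ℕ} (hR : 2 ≤ R) (hδ : 1 ≤ δ * R) (hε : 0 < ε)
    (hN : N ≤ 2 * R ^ 3) (hm : (m : ℝ) ≤ 12 * Real.log R)
    (ha : 1000000 * ε⁻¹ * Real.log R ≤ a) (hv : 10 * ε⁻¹ ≤ v) :
    N * (25 ^ m * (2 * Real.exp (-(a * (ε / 6) / 25) + a / (30 * v)))) ≤ δ / 4 := by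
  have hR0 : 0 < R := by linarith
  have hl := log_two_le_log hR
  have ha0 : 0 ≤ a := le_trans (by positivity) ha
  have h1 : a / (30 * v) ≤ a * ε / 300 := by
    have : a / (30 * v) ≤ a / (30 * (10 * ε⁻¹)) := by gcongr
    refine this.trans (le_of_eq ?_)
    field_simp
    ring
  have h2 : 1000000 * Real.log R ≤ a * ε := by
    have := mul_le_mul_of_nonneg_right ha hε.le
    refine le_trans (le_of_eq ?_) this
    field_simp
  have h3 : Real.exp (4 * m) * Real.exp (-(a * (ε / 6) / 25) + a / (30 * v)) ≤ (R ^ 8)⁻¹ := by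
    rw [← Real.exp_add, ← Real.exp_log (inv_pos.2 (pow_pos hR0 8)), Real.log_inv, Real.log_pow]
    refine Real.exp_le_exp.2 ?_
    push_cast
    linarith
  calc _ ≤ 2 * R ^ 3 * (Real.exp (4 * m) *
          (2 * Real.exp (-(a * (ε / 6) / 25) + a / (30 * v)))) := by
        gcongr
        exact pow_twentyFive_le_exp m
    _ = 4 * R ^ 3 * (Real.exp (4 * m) * Real.exp (-(a * (ε / 6) / 25) + a / (30 * v))) := by ring
    _ ≤ 4 * R ^ 3 * (R ^ 8)⁻¹ := by gcongr
    _ = 4 / R ^ 4 / R := by field_simp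
    _ ≤ 1 / 4 / R := by
        refine div_le_div_of_nonneg_right ?_ hR0.le
        rw [div_le_iff₀ (by positivity)]
        have : (2 : ℝ) ^ 4 ≤ R ^ 4 := by gcongr
        linarith
    _ ≤ δ / 4 := by
        rw [div_le_iff₀ hR0]; linarith

/-- The bound for the light coordinates: with bucket masses `m ε / L` the exponent is at least
`11 L`, which outweighs the net of `25 ^ r` points, as `r ≤ L`. -/
lemma light_failure_le {r m : ℕ} {l L δ ε a : ℝ} (hr : 1 ≤ r) (hl : 0 < l) (hδ : 0 < δ)
    (hε : 0 < ε) (hm0 : 0 < m) (hm : (m : ℝ) ≤ 12 * l) (ha : 1000000 * ε⁻¹ * l ≤ a)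
    (hL : r ≤ L) (hLδ : Real.log (1 / δ) ≤ L) :
    25 ^ r * (2 * Real.exp (-(a * (ε / 6) ^ 2 / (90 * (9 / 4 * (m * (ε / L))))))) ≤ δ / 4 := by
  have hr' : (1 : ℝ) ≤ r := by exact_mod_cast hr
  have hm' : (0 : ℝ) < m := by exact_mod_cast hm0
  have hL0 : 0 < L := by linarith
  have h1 : 11 * L ≤ a * (ε / 6) ^ 2 / (90 * (9 / 4 * (m * (ε / L)))) := by
    rw [le_div_iff₀ (by positivity)]
    have h2 : 1000000 * (ε * l) ≤ a * ε ^ 2 := by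
      refine le_trans (le_of_eq ?_) (mul_le_mul_of_nonneg_right ha (sq_nonneg ε))
      field_simp
    have h3 : 11 * L * (90 * (9 / 4 * (m * (ε / L)))) = 4455 / 2 * (ε * m) := by
      field_simp; norm_num
    have h4 : ε * m ≤ ε * (12 * l) := by gcongr
    rw [h3]
    nlinarith [mul_pos hε hl]
  have h5 : Real.exp (-L) ≤ δ := by
    rw [← Real.exp_log hδ]
    refine Real.exp_le_exp.2 ?_
    rw [one_div, Real.log_inv] at hLδ
    linarith
  have h6 : Real.exp (-6 : ℝ) ≤ 1 / 8 := by
    rw [Real.exp_neg, inv_le_comm₀ (Real.exp_pos _) (by norm_num)]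
    have := Real.add_one_le_exp (6 : ℝ)
    have h7 : Real.exp 6 = Real.exp 3 * Real.exp 3 := by rw [← Real.exp_add]; norm_num
    have := Real.add_one_le_exp (3 : ℝ)
    rw [h7]; norm_num; nlinarith
  calc _ ≤ Real.exp (4 * r) * (2 * Real.exp (-(11 * L))) := by
        gcongr
        exact pow_twentyFive_le_exp r
    _ = 2 * Real.exp (4 * r - 11 * L) := by rw [sub_eq_add_neg, Real.exp_add]; ring
    _ ≤ 2 * Real.exp (-6 + -L) := by gcongr; linarith
    _ = 2 * (Real.exp (-6) * Real.exp (-L)) := by rw [Real.exp_add]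
    _ ≤ 2 * (1 / 8 * δ) := by gcongr
    _ = δ / 4 := by ring

/-- The embedding property, with the threshold `ε / L` for heavy coordinates and the bucket load
`⌈10 log R⌉`; each of the three failure probabilities is at most `δ / 4`. -/
theorem embedding_probability {n d r : ℕ} (A : Matrix (Fin n) (Fin d) ℝ) {ε δ cq : ℝ}
    {a v q : ℕ} (hcq : 3 ≤ cq) (hA : A.rank = r) (hε : 0 < ε) (hε1 : ε < 1) (hδ : 0 < δ)
    (hδ1 : δ < 1) (hr : 2 * (ε * δ) ≤ r)
    (ha : a = ⌈1000000 * ε⁻¹ * Real.log (r / (ε * δ))⌉₊) (hv : v = ⌈10 * ε⁻¹⌉₊)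
    (hq : q = ⌈cq * r * (ε ^ 2)⁻¹ * (r + Real.log (1 / (ε * δ)))⌉₊) :
    1 - δ ≤ (uniformOn (Set.univ : Set (EmbeddingSeed n a v q))).real
      {ω | IsSubspaceEmbedding (generalizedEmbedding ω) A ε} := by
  subst hA
  have hr0 : 0 < A.rank := by
    have : (0 : ℝ) < A.rank := lt_of_lt_of_le (by positivity) hr
    exact_mod_cast this
  have hr1 : (1 : ℝ) ≤ A.rank := by exact_mod_cast hr0
  have hεδ : 0 < ε * δ := mul_pos hε hδ
  have hεδ1 : ε * δ < 1 := mul_lt_one_of_nonneg_of_lt_one_left hε.le hε1 hδ1.le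
  have hεinv : 1 ≤ ε⁻¹ := (one_le_inv₀ hε).2 hε1.le
  set R : ℝ := A.rank / (ε * δ) with hRdef
  have hR : 2 ≤ R := (le_div_iff₀ hεδ).2 hr
  have hR0 : 0 < R := by linarith
  set L : ℝ := A.rank + Real.log (1 / (ε * δ)) with hL
  have hlog0 : 0 ≤ Real.log (1 / (ε * δ)) :=
    Real.log_nonneg ((one_le_div hεδ).2 hεδ1.le)
  have hL1 : 1 ≤ L := by linarith
  have hl := log_two_le_log hR
  have hinvR : 1 / (ε * δ) ≤ R := div_le_div_of_nonneg_right hr1 hεδ.le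
  have hrR : (A.rank : ℝ) ≤ R := by
    rw [hRdef, le_div_iff₀ hεδ]; nlinarith
  have hεR : ε⁻¹ ≤ R := by
    refine le_trans ?_ hinvR
    rw [← one_div]
    gcongr
    nlinarith
  have hLR : L ≤ 2 * R := by
    have := Real.log_le_self (one_div_nonneg.2 hεδ.le)
    linarith
  have hδR : 1 ≤ δ * R := by
    have : δ * R = A.rank / ε := by rw [hRdef]; field_simp
    rw [this, le_div_iff₀ hε]; linarith
  have hN : A.rank / (ε / L) ≤ 2 * R ^ 3 := by
    calc A.rank / (ε / L) = A.rank * L * ε⁻¹ := by field_simp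
      _ ≤ R * (2 * R) * R := by gcongr
      _ = _ := by ring
  have hN0 : 0 < A.rank / (ε / L) := by positivity
  have haL : 1000000 * ε⁻¹ * Real.log R ≤ a := ha ▸ Nat.le_ceil _
  have hvL : 10 * ε⁻¹ ≤ v := hv ▸ Nat.le_ceil _
  have hqL : 3 * (A.rank / (ε / L)) ≤ q := by
    refine le_trans ?_ (hq ▸ Nat.le_ceil _)
    have : 3 * (A.rank / (ε / L)) = 3 * A.rank * ε⁻¹ * L := by field_simp
    rw [this]
    have h2 : ε⁻¹ ≤ (ε ^ 2)⁻¹ := by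
      rw [← inv_pow, sq]; nlinarith
    gcongr
  have ha0 : 0 < a := by
    have : (0 : ℝ) < a := lt_of_lt_of_le (by positivity) haL
    exact_mod_cast this
  have hv0 : v ≠ 0 := by
    have : (0 : ℝ) < v := lt_of_lt_of_le (by positivity) hvL
    have : 0 < v := by exact_mod_cast this
    omega
  have : NeZero v := ⟨hv0⟩
  have hq0 : 0 < q := by
    have : (0 : ℝ) < q := lt_of_lt_of_le (by positivity) hqL
    exact_mod_cast this
  have : Nonempty (Fin q) := ⟨⟨0, hq0⟩⟩
  have : Nonempty (Fin v) := ⟨0⟩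
  set m : ℕ := ⌈10 * Real.log R⌉₊ with hm
  have hm1 : 10 * Real.log R ≤ m := Nat.le_ceil _
  have hm2 : (m : ℝ) ≤ 12 * Real.log R := by
    have := Nat.ceil_lt_add_one (a := 10 * Real.log R) (by linarith)
    linarith
  have hm0 : 0 < m := Nat.ceil_pos.2 (by linarith)
  have hLδ : Real.log (1 / δ) ≤ L := by
    have : Real.log (1 / δ) ≤ Real.log (1 / (ε * δ)) := by
      apply Real.log_le_log (by positivity)
      gcongr
      nlinarith
    linarith
  have key := expect_not_embedding_le (a := a) (v := v) (q := q) hε hε1 ha0 A hr0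
    (T := ε / L) (by positivity) m hm0 (by linarith)
  have k1 := load_failure_le hR hδR hN0 hN hqL hm1
  have k2 := heavy_failure_le hR hδR hε hN hm2 haL hvL
  have k3 := light_failure_le (r := A.rank) hr0 (by linarith) hδ hε hm0 hm2 haL
    (by linarith) hLδ
  rw [uniformOn_univ_real_eq_expect]
  have hcompl : (𝔼 ω : EmbeddingSeed n a v q,
      ind {ω | IsSubspaceEmbedding (generalizedEmbedding ω) A ε} ω) =
      1 - 𝔼 ω : EmbeddingSeed n a v q,
        ind {ω | IsSubspaceEmbedding (generalizedEmbedding ω) A ε}ᶜ ω := by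
    rw [eq_sub_iff_add_eq, ← Finset.expect_add_distrib]
    refine (Finset.expect_congr rfl fun ω _ => ?_).trans (Fintype.expect_const 1)
    exact congrFun (Set.indicator_self_add_compl _ (1 : EmbeddingSeed n a v q → ℝ)) ω
  rw [hcompl]
  linarith

theorem mainTheorem3 :
    ∃ (P : RealRAM.Program) (c₀ : ℝ), 0 < c₀ ∧ ∀ cq : ℝ, c₀ ≤ cq →
      ∃ ca cv C : ℝ, 0 < ca ∧ 0 < cv ∧ 0 < C ∧
        ∀ (n d r : ℕ) (A : Matrix (Fin n) (Fin d) ℝ) (ε δ : ℝ) (a v q : ℕ),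
          A.rank = r → 0 < ε → ε < 1 → 0 < δ → δ < 1 → 2 * (ε * δ) ≤ r →
          a = ⌈ca * ε⁻¹ * Real.log (r / (ε * δ))⌉₊ →
          v = ⌈cv * ε⁻¹⌉₊ →
          q = ⌈cq * r * (ε ^ 2)⁻¹ * (r + Real.log (1 / (ε * δ)))⌉₊ →
          -- the number of rows
          ((a * v * q : ℕ) : ℝ) ≤
              C * (r * (ε ^ 4)⁻¹ * Real.log (r / (ε * δ)) * (r + Real.log (1 / (ε * δ)))) ∧
          -- the embedding property
          1 - δ ≤ (uniformOn (Set.univ : Set (EmbeddingSeed n a v q))).real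
              {ω | IsSubspaceEmbedding (generalizedEmbedding ω) A ε} ∧
          -- the running time
          ∀ (ω : EmbeddingSeed n a v q) (e : Fin (nnz A) ≃ NonzeroPos A),
            ∃ (k : ℕ) (τ : RealRAM.State),
              RealRAM.HaltsIn P (RealRAM.initial A e ω) k τ ∧
              RealRAM.Outputs τ (generalizedEmbedding ω * A) ∧
              (k : ℝ) ≤ C * (nnz A * ε⁻¹ * Real.log (r / (ε * δ))) ∧
              ∀ κ : ℝ, 0 ≤ κ → ε⁻¹ ≤ (r / δ) ^ κ →
                (k : ℝ) ≤ C * (1 + κ) * (nnz A * ε⁻¹ * Real.log (r / δ)) := by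
  refine ⟨RealRAM.sketchProgram, 3, by norm_num, fun cq hcq =>
    ⟨1000000, 10, 30 * 1000002 * (11 * (cq + 1)), by norm_num, by norm_num, by positivity, ?_⟩⟩
  intro n d r A ε δ a v q hA hε hε1 hδ hδ1 hr ha hv hq
  have hprob := embedding_probability A hcq hA hε hε1 hδ hδ1 hr ha hv hq
  have hr0 : 0 < r := by
    have : (0 : ℝ) < r := lt_of_lt_of_le (by positivity) hr
    exact_mod_cast this
  have hr1 : (1 : ℝ) ≤ r := by exact_mod_cast hr0
  have hεδ : 0 < ε * δ := mul_pos hε hδ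
  have hεδ1 : ε * δ < 1 := mul_lt_one_of_nonneg_of_lt_one_left hε.le hε1 hδ1.le
  have hεinv : 1 ≤ ε⁻¹ := (one_le_inv₀ hε).2 hε1.le
  have hl := log_two_le_log ((le_div_iff₀ hεδ).2 hr)
  set l : ℝ := Real.log (r / (ε * δ)) with hldef
  set L : ℝ := r + Real.log (1 / (ε * δ)) with hL
  have hL1 : 1 ≤ L := by
    have : 0 ≤ Real.log (1 / (ε * δ)) := Real.log_nonneg ((one_le_div hεδ).2 hεδ1.le)
    linarith
  -- The roundings cost constant factors only.
  have ha1 : 1 ≤ a := ha ▸ Nat.ceil_pos.2 (by positivity)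
  have haU : (a : ℝ) ≤ 1000002 * (ε⁻¹ * l) := by
    have h1 := Nat.ceil_lt_add_one (a := 1000000 * ε⁻¹ * l) (by positivity)
    rw [← ha] at h1
    nlinarith
  have hvU : (v : ℝ) ≤ 11 * ε⁻¹ := by
    have h1 := Nat.ceil_lt_add_one (a := 10 * ε⁻¹) (by positivity)
    rw [← hv] at h1
    linarith
  have hqU : (q : ℝ) ≤ (cq + 1) * (r * (ε ^ 2)⁻¹ * L) := by
    have h1 := Nat.ceil_lt_add_one (a := cq * r * (ε ^ 2)⁻¹ * L) (by positivity)
    rw [← hq] at h1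
    have h2 : 1 ≤ (ε ^ 2)⁻¹ := by rw [← inv_pow]; exact one_le_pow₀ hεinv
    have h3 : 1 ≤ r * (ε ^ 2)⁻¹ * L := one_le_mul_of_one_le_of_one_le
      (one_le_mul_of_one_le_of_one_le hr1 h2) hL1
    linarith
  refine ⟨?_, hprob, fun ω e => ?_⟩
  · calc ((a * v * q : ℕ) : ℝ) = a * v * q := by push_cast; ring
      _ ≤ 1000002 * (ε⁻¹ * l) * (11 * ε⁻¹) * ((cq + 1) * (r * (ε ^ 2)⁻¹ * L)) := by gcongr
      _ = 1000002 * (11 * (cq + 1)) * (r * (ε ^ 4)⁻¹ * l * L) := by field_simp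
      _ ≤ 30 * 1000002 * (11 * (cq + 1)) * (r * (ε ^ 4)⁻¹ * l * L) := by
        gcongr
        norm_num
  · obtain ⟨τ, hτ, hout⟩ := RealRAM.sketchProgram_spec A ω e
    have hnnz : 1 ≤ nnz A := by
      rw [Nat.one_le_iff_ne_zero]
      intro h0
      have hempty : IsEmpty (NonzeroPos A) := Finite.card_eq_zero_iff.1 h0
      have hA0 : A = 0 := by
        ext i j
        by_contra hij
        exact hempty.false ⟨(i, j), hij⟩
      rw [hA0, Matrix.rank_zero] at hA
      omega
    have hk : ((nnz A * (15 * a + 12) + 3 : ℕ) : ℝ) ≤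
        30 * 1000002 * (11 * (cq + 1)) * (nnz A * ε⁻¹ * l) := by
      calc ((nnz A * (15 * a + 12) + 3 : ℕ) : ℝ) ≤ ((30 * (nnz A * a) : ℕ) : ℝ) := by
            have h1 : 1 ≤ nnz A * a := Nat.mul_pos hnnz ha1
            have h2 : nnz A ≤ nnz A * a := Nat.le_mul_of_pos_right _ ha1
            exact_mod_cast (by nlinarith)
        _ = 30 * (nnz A * a) := by push_cast; ring
        _ ≤ 30 * (nnz A * (1000002 * (ε⁻¹ * l))) := by gcongr
        _ = 30 * 1000002 * 1 * (nnz A * ε⁻¹ * l) := by ring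
        _ ≤ _ := by gcongr; linarith
    refine ⟨_, τ, hτ, hout, hk, fun κ hκ hεκ => hk.trans ?_⟩
    have hrδ : 0 < r / δ := by positivity
    have hll : l ≤ (1 + κ) * Real.log (r / δ) := by
      have h1 : l = Real.log (r / δ) + Real.log ε⁻¹ := by
        rw [hldef, ← Real.log_mul hrδ.ne' (by positivity)]
        congr 1
        field_simp
      have h2 := Real.log_le_log (by positivity) hεκ
      rw [Real.log_rpow hrδ] at h2
      linarith
    calc _ ≤ 30 * 1000002 * (11 * (cq + 1)) * (nnz A * ε⁻¹ * ((1 + κ) * Real.log (r / δ))) := by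
          gcongr
      _ = _ := by ring

end
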